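/- Let $(\varepsilon_t)_{t\in\mathbb Z}$ be i.i.d. centered Gaussian random variables with variance $\mathbf E[\varepsilon_0^2]\in(0,\infty)$, and set $\nu=\sup\{p>1:\|\varepsilon_0\|_{L^p}<\infty\}$ and $\alpha=2\wedge\nu$ (here $\nu=\infty$, $\alpha=2$). Let $(a_j)_{j\ge0}$ be real coefficients such that, for some $d\in(0,1-1/\alpha)=(0,1/2)$, $n^{1-d}a_n\to c_a$ with $c_a$ finite and nonzero. Let $X_t=\sum_{j=0}^\infty a_j\varepsilon_{t-j}$ (limit of the partial sums, almost surely convergent) and $\tau^2=\operatorname{Var}(X_0)$. Put $$\kappa_0=\begin{cases}\dfrac{1}{2(1-d)} & \text{if } \dfrac1{(1-d)(1-2d)}<2,\\[6pt] \dfrac{2(1-d)+1-2(1-d)(1-2d)}{2(1-d)+1} & \text{otherwise.}\end{cases}$$ Let $u_n\to\infty$ be such that, for some $\delta>0$, $$u_n=\tau\bigl(-2\log(n)(\kappa_0+\delta-\tfrac12-d)+o(1)\bigr)^{1/2}.$$ Then, as $n\to\infty$, $$\frac{n^{1/2-d}\,\tau^2}{u_n}\left(\frac{\sum_{t=1}^n\mathbb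 1\{X_t>u_n\}}{n\,\mathbf P[X_0>u_n]}-1\right)\xrightarrow{d}Z_2$$ and $$\frac{n^{1/2-d}\,\tau^2}{u_n}\cdot\frac{1}{\mathbf E[\log(X_0/u_n)\mid X_0>u_n]}\left(\frac{\sum_{t=1}^n\log(X_t/u_n)_+}{n\,\mathbf P[X_0>u_n]}-\mathbf E[\log(X_0/u_n)\mid X_0>u_n]\right)\xrightarrow{d}Z_2,$$ where $Z_2\sim\mathcal N(0,\sigma^2)$ with $\sigma^2=c_a^2\,\mathbf E[\varepsilon_0^2]\,\dfrac{B(1-2d,d)}{d(2d+1)}$, $B$ being the Euler beta function. The rate is slower than the classical long-memory rate: $n^{1/2-d}\tau^2/u_n=o(n^{1/2-d})$. In particular, if $\operatorname{Var}(X_0)=1$, the thresholds are $u_n=(-2\log(n)(\kappa_0+\delta-\tfrac12-d)+o(1))^{1/2}$ and the rate is $n^{1/2-d}/u_n$. -/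

import Mathlib

open MeasureTheory ProbabilityTheory Filter Topology
open scoped ENNReal NNReal

noncomputable section

namespace LongMemoryExtremes

variable {Ω : Type*} [MeasurableSpace Ω]

/-- The moment index `ν = sup {p > 1 | ‖Y‖_{L^p(P)} < ∞}` of a random variable `Y`
(the supremum over real exponents `p`, taken in `[0, ∞]`). -/
def momentIndex (Y : Ω → ℝ) (P : Measure Ω) : ℝ≥0∞ :=
  sSup {p : ℝ≥0∞ | 1 < p ∧ p ≠ ∞ ∧ MemLp Y p P}

/-- The index `α = 2 ∧ ν`. -/
def stabilityIndex (Y : Ω → ℝ) (P : Measure Ω) : ℝ :=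
  (min 2 (momentIndex Y P)).toReal

/-- The long memory assumption on the coefficients `a` of a linear process whose innovations are
distributed as `Y`, with memory parameter `d` and limit constant `c`. -/
structure LongMemory (a : ℕ → ℝ) (Y : Ω → ℝ) (P : Measure Ω) (d c : ℝ) : Prop where
  one_lt_momentIndex : 1 < momentIndex Y P
  d_pos : 0 < d
  d_lt : d < 1 - 1 / stabilityIndex Y P
  c_ne_zero : c ≠ 0
  tendsto_coeff : Tendsto (fun n : ℕ => (n : ℝ) ^ (1 - d) * a n) atTop (𝓝 c)

/-- The linear process `X_t = ∑_{j ≥ 0} a_j ε_{t-j}`. The series is the limit of its partial sums: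
under long memory it converges almost surely, but in general not absolutely, so that the
unconditional sum `∑'` would be the wrong notion. -/
def linearProcess (a : ℕ → ℝ) (ε : ℤ → Ω → ℝ) (t : ℤ) (ω : Ω) : ℝ :=
  limUnder atTop (fun N : ℕ => ∑ j ∈ Finset.range N, a j * ε (t - (j : ℤ)) ω)

/-- The optimal exponent `κ₀`, as a function of `α` and `d`. -/
def kappaZero (α d : ℝ) : ℝ :=
  if 1 / ((1 - d) * (1 - 2 * d)) < α then
    1 / (α * (1 - d))
  else
    (2 * (1 - d) + (1 - α * (1 - d) * (1 - 2 * d))) / (α * (1 - d) + 1)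

/-- The variance `σ² = c² E[ε²] B(1 - 2d, d) / (d (2d + 1))` of the limit `Z₂`, where `s = E[ε²]`
and `B` is Euler's beta function. -/
def limitVariance (c s d : ℝ) : ℝ :=
  c ^ 2 * s * ProbabilityTheory.beta (1 - 2 * d) d / (d * (2 * d + 1))

/-- `log (x / u)_+`, i.e. `log (x / u)` for `x > u` and `0` otherwise. -/
def logExcess (u x : ℝ) : ℝ :=
  (Set.Ioi u).indicator (fun y => Real.log (y / u)) x

/-- The tail probability `P[X₀ > u]`. -/
def tailProb (X : ℤ → Ω → ℝ) (P : Measure Ω) (u : ℝ) : ℝ :=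
  P.real {ω | u < X 0 ω}

/-- The conditional expectation `E[log (X₀ / u) | X₀ > u]` given the event `X₀ > u`. -/
def meanLogExcess (X : ℤ → Ω → ℝ) (P : Measure Ω) (u : ℝ) : ℝ :=
  ∫ ω, Real.log (X 0 ω / u) ∂(ProbabilityTheory.cond P {ω | u < X 0 ω})

/-- The centered exceedance count `(∑_{t=1}^n 1{X_t > u}) / (n P[X₀ > u]) - 1`. -/
def exceedanceError (X : ℤ → Ω → ℝ) (P : Measure Ω) (n : ℕ) (u : ℝ) (ω : Ω) : ℝ :=
  (∑ t ∈ Finset.Icc 1 n, (Set.Ioi u).indicator (fun _ => (1 : ℝ)) (X (t : ℤ) ω)) /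
    (n * tailProb X P u) - 1

/-- The centered Hill-type statistic
`(∑_{t=1}^n log (X_t / u)_+) / (n P[X₀ > u]) - E[log (X₀ / u) | X₀ > u]`. -/
def hillError (X : ℤ → Ω → ℝ) (P : Measure Ω) (n : ℕ) (u : ℝ) (ω : Ω) : ℝ :=
  (∑ t ∈ Finset.Icc 1 n, logExcess u (X (t : ℤ) ω)) / (n * tailProb X P u) -
    meanLogExcess X P u

end LongMemoryExtremes

end

namespace LongMemoryExtremes

/-! ### Integrals against Gaussian measures -/

section Mehler

/-- The Cauchy-Schwarz inequality for integrals of real functions. -/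
lemma sq_integral_mul_le {α : Type*} [MeasurableSpace α] {μ : Measure α} {f g : α → ℝ}
    (hf : MemLp f 2 μ) (hg : MemLp g 2 μ) :
    (∫ x, f x * g x ∂μ) ^ 2 ≤ (∫ x, f x ^ 2 ∂μ) * ∫ x, g x ^ 2 ∂μ := by
  have hfg : Integrable (fun x => f x * g x) μ := hf.integrable_mul hg
  have key : ∀ t : ℝ, 0 ≤ (∫ x, g x ^ 2 ∂μ) * (t * t) + (2 * ∫ x, f x * g x ∂μ) * t
      + ∫ x, f x ^ 2 ∂μ := by
    intro t
    have h1 : ∫ x, (f x + t * g x) ^ 2 ∂μ = (∫ x, g x ^ 2 ∂μ) * (t * t)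
        + (2 * ∫ x, f x * g x ∂μ) * t + ∫ x, f x ^ 2 ∂μ := by
      have h2 : ∀ x, (f x + t * g x) ^ 2
          = g x ^ 2 * (t * t) + (f x * g x) * (2 * t) + f x ^ 2 := fun x => by ring
      simp_rw [h2]
      rw [integral_add ((hg.integrable_sq.mul_const _).fun_add (hfg.mul_const _)) hf.integrable_sq,
        integral_add (hg.integrable_sq.mul_const _) (hfg.mul_const _), integral_mul_const,
        integral_mul_const]
      ring
    rw [← h1]
    exact integral_nonneg fun x => sq_nonneg _
  have := discrim_le_zero key
  rw [discrim] at this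
  nlinarith

/-- The density of `N(m, s)` with respect to the standard Gaussian law. -/
noncomputable def gaussianRatio (m : ℝ) (s : ℝ≥0) (y : ℝ) : ℝ :=
  gaussianPDFReal m s y / gaussianPDFReal 0 1 y

lemma measurable_gaussianRatio (m : ℝ) (s : ℝ≥0) : Measurable (gaussianRatio m s) :=
  (measurable_gaussianPDFReal m s).div (measurable_gaussianPDFReal 0 1)

lemma gaussianPDFReal_mul_gaussianRatio (m : ℝ) (s : ℝ≥0) (y : ℝ) :
    gaussianPDFReal 0 1 y * gaussianRatio m s y = gaussianPDFReal m s y := by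
  have := gaussianPDFReal_pos 0 1 y one_ne_zero
  rw [gaussianRatio]
  field_simp

lemma integral_mul_gaussianRatio {s : ℝ≥0} (hs : s ≠ 0) (m : ℝ) (h : ℝ → ℝ) :
    ∫ y, h y * gaussianRatio m s y ∂(gaussianReal 0 1) = ∫ y, h y ∂(gaussianReal m s) := by
  rw [integral_gaussianReal_eq_integral_smul one_ne_zero,
    integral_gaussianReal_eq_integral_smul hs]
  refine integral_congr_ae (ae_of_all _ fun y => ?_)
  simp only [smul_eq_mul]
  rw [← gaussianPDFReal_mul_gaussianRatio m s y]
  ring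

lemma integrable_gaussianReal_iff {s : ℝ≥0} (hs : s ≠ 0) (m : ℝ) (h : ℝ → ℝ) :
    Integrable h (gaussianReal m s) ↔ Integrable (fun y => gaussianPDFReal m s y * h y) := by
  rw [gaussianReal_of_var_ne_zero m hs, integrable_withDensity_iff_integrable_smul₀'
    (measurable_gaussianPDF m s).aemeasurable (ae_of_all _ fun _ => gaussianPDF_lt_top)]
  simp [toReal_gaussianPDF]

/-- The square of the Mehler kernel, up to the reference density, is again a Gaussian density. -/
lemma gaussianPDFReal_mul_gaussianRatio_sq {ρ : ℝ} {q p : ℝ≥0} (hρ : ρ ^ 2 < 1)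
    (hq : (q : ℝ) = 1 - ρ ^ 2) (hp : (p : ℝ) = (1 - ρ ^ 2) / (1 + ρ ^ 2)) (x y : ℝ) :
    gaussianPDFReal 0 1 y * gaussianRatio (ρ * x) q y ^ 2
      = (√(1 - ρ ^ 4))⁻¹ * Real.exp (ρ ^ 2 * x ^ 2 / (1 + ρ ^ 2)) *
        gaussianPDFReal (2 * ρ * x / (1 + ρ ^ 2)) p y := by
  have h0 : 0 < 1 - ρ ^ 2 := by linarith
  have h1 : 0 < 1 + ρ ^ 2 := by positivity
  have hpi := Real.pi_pos
  have hφ := gaussianPDFReal_pos 0 1 y one_ne_zero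
  rw [gaussianRatio, div_pow, mul_div_assoc', pow_two (gaussianPDFReal 0 1 y),
    mul_div_mul_left _ _ hφ.ne']
  simp only [gaussianPDFReal_def, hq, hp, NNReal.coe_one]
  rw [div_eq_iff (by positivity), mul_pow, ← Real.exp_nat_mul]
  have e1 : ((2 : ℕ) : ℝ) * (-(y - ρ * x) ^ 2 / (2 * (1 - ρ ^ 2)))
      = ρ ^ 2 * x ^ 2 / (1 + ρ ^ 2) + (-(y - 2 * ρ * x / (1 + ρ ^ 2)) ^ 2
        / (2 * ((1 - ρ ^ 2) / (1 + ρ ^ 2)))) + (-(y - 0) ^ 2 / (2 * 1)) := by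
    push_cast
    field_simp
    ring
  rw [e1, Real.exp_add, Real.exp_add]
  have e2 : (√(2 * Real.pi * (1 - ρ ^ 2)))⁻¹ ^ 2
      = (√(1 - ρ ^ 4))⁻¹ * (√(2 * Real.pi * ((1 - ρ ^ 2) / (1 + ρ ^ 2))))⁻¹
        * (√(2 * Real.pi * 1))⁻¹ := by
    have h4 : 0 ≤ 1 - ρ ^ 4 := by nlinarith
    rw [inv_pow, Real.sq_sqrt (by positivity), ← mul_inv, ← mul_inv, ← Real.sqrt_mul h4,
      ← Real.sqrt_mul (by positivity)]
    congr 1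
    rw [show (1 - ρ ^ 4) * (2 * Real.pi * ((1 - ρ ^ 2) / (1 + ρ ^ 2))) * (2 * Real.pi * 1)
      = (2 * Real.pi * (1 - ρ ^ 2)) ^ 2 by field_simp; ring]
    exact (Real.sqrt_sq (by positivity)).symm
  rw [e2]
  ring

lemma gaussianPDFReal_mul_exp {ρ : ℝ} {p : ℝ≥0} (hρ : ρ ^ 2 < 1)
    (hp : (p : ℝ) = (1 + ρ ^ 2) / (1 - ρ ^ 2)) (x : ℝ) :
    gaussianPDFReal 0 1 x * ((√(1 - ρ ^ 4))⁻¹ * Real.exp (ρ ^ 2 * x ^ 2 / (1 + ρ ^ 2)))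
      = (1 - ρ ^ 2)⁻¹ * gaussianPDFReal 0 p x := by
  have h0 : 0 < 1 - ρ ^ 2 := by linarith
  have h1 : 0 < 1 + ρ ^ 2 := by positivity
  have hpi := Real.pi_pos
  simp only [gaussianPDFReal_def, hp, NNReal.coe_one]
  have e1 : -(x - 0) ^ 2 / (2 * ((1 + ρ ^ 2) / (1 - ρ ^ 2)))
      = -(x - 0) ^ 2 / (2 * 1) + ρ ^ 2 * x ^ 2 / (1 + ρ ^ 2) := by
    field_simp
    ring
  rw [e1, Real.exp_add]
  have h4 : 0 ≤ 1 - ρ ^ 4 := by nlinarith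
  have e2 : (1 - ρ ^ 2)⁻¹ * (√(2 * Real.pi * ((1 + ρ ^ 2) / (1 - ρ ^ 2))))⁻¹
      = (√(2 * Real.pi * 1))⁻¹ * (√(1 - ρ ^ 4))⁻¹ := by
    rw [← mul_inv, ← mul_inv, ← Real.sqrt_mul (by positivity)]
    congr 1
    nth_rewrite 1 [← Real.sqrt_sq h0.le]
    rw [← Real.sqrt_mul (by positivity)]
    congr 1
    field_simp
    ring
  linear_combination (Real.exp (-(x - 0) ^ 2 / (2 * 1))
    * Real.exp (ρ ^ 2 * x ^ 2 / (1 + ρ ^ 2))) * (-e2)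

variable {ρ : ℝ} {q : ℝ≥0}

lemma memLp_gaussianRatio (hρ : ρ ^ 2 < 1) (hq : (q : ℝ) = 1 - ρ ^ 2) (x : ℝ) :
    MemLp (gaussianRatio (ρ * x) q) 2 (gaussianReal 0 1) := by
  have h0 : 0 < 1 - ρ ^ 2 := by linarith
  rw [memLp_two_iff_integrable_sq (measurable_gaussianRatio _ _).aestronglyMeasurable,
    integrable_gaussianReal_iff one_ne_zero]
  have hp : (((1 - ρ ^ 2) / (1 + ρ ^ 2)).toNNReal : ℝ) = (1 - ρ ^ 2) / (1 + ρ ^ 2) :=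
    Real.coe_toNNReal _ (by positivity)
  simp_rw [gaussianPDFReal_mul_gaussianRatio_sq hρ hq hp]
  exact (integrable_gaussianPDFReal _ _).const_mul _

lemma integral_gaussianRatio_sq (hρ : ρ ^ 2 < 1) (hq : (q : ℝ) = 1 - ρ ^ 2) (x : ℝ) :
    ∫ y, gaussianRatio (ρ * x) q y ^ 2 ∂(gaussianReal 0 1)
      = (√(1 - ρ ^ 4))⁻¹ * Real.exp (ρ ^ 2 * x ^ 2 / (1 + ρ ^ 2)) := by
  have h0 : 0 < 1 - ρ ^ 2 := by linarith
  have h1 : 0 < (1 - ρ ^ 2) / (1 + ρ ^ 2) := by positivity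
  rw [integral_gaussianReal_eq_integral_smul one_ne_zero]
  have hp : (((1 - ρ ^ 2) / (1 + ρ ^ 2)).toNNReal : ℝ) = (1 - ρ ^ 2) / (1 + ρ ^ 2) :=
    Real.coe_toNNReal _ h1.le
  simp_rw [smul_eq_mul, gaussianPDFReal_mul_gaussianRatio_sq hρ hq hp]
  rw [integral_const_mul, integral_gaussianPDFReal_eq_one _ (by simpa using h1), mul_one]

lemma memLp_id_two : MemLp (fun x : ℝ => x) 2 (gaussianReal 0 1) :=
  memLp_id_gaussianReal' 2 (by simp)

lemma integral_sq_gaussianReal : ∫ x, x ^ 2 ∂(gaussianReal 0 1) = 1 := by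
  have h := variance_fun_id_gaussianReal (μ := 0) (v := 1)
  rw [variance_of_integral_eq_zero (by fun_prop) (by simp)] at h
  simpa using h

/-- The squared distance of the Mehler kernel to its projection on affine functions. -/
lemma integral_gaussianRatio_sub_sq (hρ : ρ ^ 2 < 1) (hq : (q : ℝ) = 1 - ρ ^ 2) (x : ℝ) :
    ∫ y, (gaussianRatio (ρ * x) q y - 1 - ρ * x * y) ^ 2 ∂(gaussianReal 0 1)
      = (√(1 - ρ ^ 4))⁻¹ * Real.exp (ρ ^ 2 * x ^ 2 / (1 + ρ ^ 2)) - 1 - ρ ^ 2 * x ^ 2 := by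
  have hq0 : q ≠ 0 := by
    intro h
    rw [h] at hq
    simp at hq
    linarith
  have hK := memLp_gaussianRatio hρ hq x
  have hy := memLp_id_two
  have i1 := hK.integrable_sq
  have i2 : Integrable (gaussianRatio (ρ * x) q) (gaussianReal 0 1) := hK.integrable one_le_two
  have i3 : Integrable (fun y : ℝ => y * gaussianRatio (ρ * x) q y) (gaussianReal 0 1) :=
    hy.integrable_mul hK
  have i4 : Integrable (fun y : ℝ => y) (gaussianReal 0 1) := hy.integrable one_le_two
  have i5 := hy.integrable_sq
  have e : ∀ y, (gaussianRatio (ρ * x) q y - 1 - ρ * x * y) ^ 2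
      = gaussianRatio (ρ * x) q y ^ 2 + ((-2) * gaussianRatio (ρ * x) q y
        + ((-2 * ρ * x) * (y * gaussianRatio (ρ * x) q y)
        + ((2 * ρ * x) * y + ((ρ * x) ^ 2 * y ^ 2 + 1)))) := fun y => by ring
  simp_rw [e]
  have v1 : ∫ y, gaussianRatio (ρ * x) q y ∂(gaussianReal 0 1) = 1 := by
    simpa using integral_mul_gaussianRatio hq0 (ρ * x) (fun _ => 1)
  have v2 : ∫ y, y * gaussianRatio (ρ * x) q y ∂(gaussianReal 0 1) = ρ * x := by
    rw [integral_mul_gaussianRatio hq0 (ρ * x) (fun y => y), integral_id_gaussianReal]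
  have j5 : Integrable (fun y : ℝ => (ρ * x) ^ 2 * y ^ 2 + 1) (gaussianReal 0 1) :=
    (i5.const_mul _).fun_add (integrable_const _)
  have j4 := (i4.const_mul (2 * ρ * x)).fun_add j5
  have j3 := (i3.const_mul (-2 * ρ * x)).fun_add j4
  have j2 := (i2.const_mul (-2)).fun_add j3
  rw [integral_add i1 j2, integral_add (i2.const_mul _) j3, integral_add (i3.const_mul _) j4,
    integral_add (i4.const_mul _) j5, integral_add (i5.const_mul _) (integrable_const _),
    integral_const_mul, integral_const_mul, integral_const_mul, integral_const_mul, v1, v2,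
    integral_gaussianRatio_sq hρ hq, integral_id_gaussianReal, integral_sq_gaussianReal]
  simp
  ring

lemma integrable_mehler_diag (hρ : ρ ^ 2 < 1) :
    Integrable (fun x => (√(1 - ρ ^ 4))⁻¹ * Real.exp (ρ ^ 2 * x ^ 2 / (1 + ρ ^ 2)))
      (gaussianReal 0 1) := by
  have h0 : 0 < 1 - ρ ^ 2 := by linarith
  rw [integrable_gaussianReal_iff one_ne_zero]
  have hp : (((1 + ρ ^ 2) / (1 - ρ ^ 2)).toNNReal : ℝ) = (1 + ρ ^ 2) / (1 - ρ ^ 2) :=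
    Real.coe_toNNReal _ (by positivity)
  simp_rw [gaussianPDFReal_mul_exp hρ hp]
  exact (integrable_gaussianPDFReal _ _).const_mul _

lemma integral_mehler_diag (hρ : ρ ^ 2 < 1) :
    ∫ x, (√(1 - ρ ^ 4))⁻¹ * Real.exp (ρ ^ 2 * x ^ 2 / (1 + ρ ^ 2)) ∂(gaussianReal 0 1)
      = (1 - ρ ^ 2)⁻¹ := by
  have h0 : 0 < 1 - ρ ^ 2 := by linarith
  have h1 : 0 < (1 + ρ ^ 2) / (1 - ρ ^ 2) := by positivity
  rw [integral_gaussianReal_eq_integral_smul one_ne_zero]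
  have hp : (((1 + ρ ^ 2) / (1 - ρ ^ 2)).toNNReal : ℝ) = (1 + ρ ^ 2) / (1 - ρ ^ 2) :=
    Real.coe_toNNReal _ h1.le
  simp_rw [smul_eq_mul, gaussianPDFReal_mul_exp hρ hp]
  rw [integral_const_mul, integral_gaussianPDFReal_eq_one _ (by simpa using h1), mul_one]

/-- The Ornstein-Uhlenbeck (Mehler) operator contracts by `ρ²` on functions without affine part. -/
lemma sq_integral_mul_mehler_le (hρ : ρ ^ 2 < 1) (hq : (q : ℝ) = 1 - ρ ^ 2) {f : ℝ → ℝ}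
    (hf : MemLp f 2 (gaussianReal 0 1)) (h0 : ∫ x, f x ∂(gaussianReal 0 1) = 0)
    (h1 : ∫ x, x * f x ∂(gaussianReal 0 1) = 0) :
    (∫ x, f x * ∫ y, f y ∂(gaussianReal (ρ * x) q) ∂(gaussianReal 0 1)) ^ 2
      ≤ (∫ x, f x ^ 2 ∂(gaussianReal 0 1)) ^ 2 * (ρ ^ 4 / (1 - ρ ^ 2)) := by
  have hpos : 0 < 1 - ρ ^ 2 := by linarith
  have hq0 : q ≠ 0 := by
    intro h
    rw [h] at hq
    simp at hq
    linarith
  set S := ∫ x, f x ^ 2 ∂(gaussianReal 0 1) with hS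
  have hS0 : 0 ≤ S := integral_nonneg fun x => sq_nonneg _
  set T : ℝ → ℝ := fun x => ∫ y, f y ∂(gaussianReal (ρ * x) q) with hT
  set M : ℝ → ℝ := fun x => (√(1 - ρ ^ 4))⁻¹ * Real.exp (ρ ^ 2 * x ^ 2 / (1 + ρ ^ 2)) - 1
    - ρ ^ 2 * x ^ 2 with hM
  have hTx : ∀ x, T x = ∫ y, f y * (gaussianRatio (ρ * x) q y - 1 - ρ * x * y)
      ∂(gaussianReal 0 1) := by
    intro x
    have i1 : Integrable (fun y => f y * gaussianRatio (ρ * x) q y) (gaussianReal 0 1) :=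
      hf.integrable_mul (memLp_gaussianRatio hρ hq x)
    have i2 : Integrable f (gaussianReal 0 1) := hf.integrable one_le_two
    have i3 : Integrable (fun y => y * f y) (gaussianReal 0 1) := memLp_id_two.integrable_mul hf
    have e : ∀ y, f y * (gaussianRatio (ρ * x) q y - 1 - ρ * x * y)
        = f y * gaussianRatio (ρ * x) q y - f y - (ρ * x) * (y * f y) := fun y => by ring
    simp_rw [e]
    have i4 : Integrable (fun y => f y * gaussianRatio (ρ * x) q y - f y) (gaussianReal 0 1) :=
      i1.sub i2
    rw [integral_sub i4 (i3.const_mul _), integral_sub i1 i2, integral_const_mul, h0, h1,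
      integral_mul_gaussianRatio hq0]
    simp [hT]
  have hTM : ∀ x, T x ^ 2 ≤ S * M x := by
    intro x
    rw [hTx, show M x = _ from (integral_gaussianRatio_sub_sq hρ hq x).symm]
    refine sq_integral_mul_le hf ?_
    exact ((memLp_gaussianRatio hρ hq x).sub (memLp_const 1)).sub (memLp_id_two.const_mul _)
  have hMi : Integrable M (gaussianReal 0 1) :=
    ((integrable_mehler_diag hρ).sub (integrable_const _)).sub
      (memLp_id_two.integrable_sq.const_mul _)
  have hMint : ∫ x, M x ∂(gaussianReal 0 1) = ρ ^ 4 / (1 - ρ ^ 2) := by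
    have i1 : Integrable (fun x => (√(1 - ρ ^ 4))⁻¹ * Real.exp (ρ ^ 2 * x ^ 2 / (1 + ρ ^ 2)) - 1)
        (gaussianReal 0 1) := (integrable_mehler_diag hρ).sub (integrable_const _)
    simp only [hM]
    rw [integral_sub i1
      (memLp_id_two.integrable_sq.const_mul _), integral_sub (integrable_mehler_diag hρ)
      (integrable_const _), integral_mehler_diag hρ, integral_const_mul, integral_sq_gaussianReal]
    simp
    field_simp
    ring
  have hTmeas : AEStronglyMeasurable T (gaussianReal 0 1) := by
    obtain ⟨g, hg, hfg⟩ := hf.1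
    have : T = fun x => ∫ y, g y * gaussianRatio (ρ * x) q y ∂(gaussianReal 0 1) := by
      funext x
      rw [hT]
      simp only
      rw [← integral_mul_gaussianRatio hq0]
      refine integral_congr_ae ?_
      filter_upwards [hfg] with y hy
      rw [hy]
    rw [this]
    have hm : Measurable (fun p : ℝ × ℝ => g p.2 * gaussianRatio (ρ * p.1) q p.2) := by
      refine (hg.measurable.comp measurable_snd).mul ?_
      unfold gaussianRatio
      refine Measurable.div ?_ ((measurable_gaussianPDFReal 0 1).comp measurable_snd)
      simp only [gaussianPDFReal_def]
      fun_prop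
    exact (hm.stronglyMeasurable.integral_prod_right).aestronglyMeasurable
  have hT2 : MemLp T 2 (gaussianReal 0 1) := by
    rw [memLp_two_iff_integrable_sq hTmeas]
    refine (hMi.const_mul S).mono' (hTmeas.pow 2) (ae_of_all _ fun x => ?_)
    rw [Real.norm_of_nonneg (sq_nonneg _)]
    exact hTM x
  calc (∫ x, f x * T x ∂(gaussianReal 0 1)) ^ 2
      ≤ S * ∫ x, T x ^ 2 ∂(gaussianReal 0 1) := sq_integral_mul_le hf hT2
    _ ≤ S * ∫ x, S * M x ∂(gaussianReal 0 1) := by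
        gcongr
        · exact hT2.integrable_sq
        · exact hMi.const_mul S
        · exact fun x => hTM x
    _ = S ^ 2 * (ρ ^ 4 / (1 - ρ ^ 2)) := by
        rw [integral_const_mul, hMint]
        ring

end Mehler

/-! ### Gaussian tails -/

section Tail

lemma gaussianPDFReal_zero_one (x : ℝ) :
    gaussianPDFReal 0 1 x = (√(2 * Real.pi))⁻¹ * Real.exp (-x ^ 2 / 2) := by
  simp [gaussianPDFReal_def]

lemma hasDerivAt_gaussianPDFReal (x : ℝ) :
    HasDerivAt (gaussianPDFReal 0 1) (-x * gaussianPDFReal 0 1 x) x := by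
  have h : HasDerivAt (fun y : ℝ => -y ^ 2 / 2) (-x) x := by
    have := ((hasDerivAt_pow 2 x).neg).div_const 2
    convert! this using 1
    simp
    ring
  have h2 := (h.exp).const_mul ((√(2 * Real.pi))⁻¹)
  rw [show gaussianPDFReal 0 1 = fun y => (√(2 * Real.pi))⁻¹ * Real.exp (-y ^ 2 / 2) from
    funext gaussianPDFReal_zero_one]
  convert! h2 using 1
  ring

lemma integrable_pow_mul_gaussianPDFReal (k : ℕ) :
    Integrable (fun x : ℝ => x ^ k * gaussianPDFReal 0 1 x) := by
  have h : Integrable (fun x : ℝ => x ^ k) (gaussianReal 0 1) := by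
    have := (memLp_id_gaussianReal (μ := 0) (v := 1) (k : ℝ≥0)).integrable_norm_pow'
    refine (integrable_norm_iff (by fun_prop)).1 ?_
    simpa using this
  rw [integrable_gaussianReal_iff one_ne_zero] at h
  simpa [mul_comm] using h

lemma tendsto_mul_gaussianPDFReal :
    Tendsto (fun x : ℝ => x * gaussianPDFReal 0 1 x) atTop (𝓝 0) := by
  have h1 := (Real.tendsto_pow_mul_exp_neg_atTop_nhds_zero 1).const_mul ((√(2 * Real.pi))⁻¹)
  rw [mul_zero] at h1
  refine squeeze_zero' ?_ ?_ h1
  · filter_upwards [eventually_ge_atTop 0] with x hx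
    exact mul_nonneg hx (gaussianPDFReal_nonneg _ _ _)
  · filter_upwards [eventually_ge_atTop 2] with x hx
    rw [gaussianPDFReal_zero_one, pow_one, mul_left_comm]
    have : Real.exp (-x ^ 2 / 2) ≤ Real.exp (-x) := Real.exp_le_exp.2 (by nlinarith)
    gcongr

/-- The conditions on `g` under which `g 1_{(w, ∞)}` behaves like the exceedance indicator. -/
structure TailProfile (w : ℝ) (g g' : ℝ → ℝ) : Prop where
  two_le : 2 ≤ w
  measurable : Measurable g
  measurable_deriv : Measurable g'
  continuousWithinAt : ContinuousWithinAt g (Set.Ici w) w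
  hasDerivAt : ∀ x ∈ Set.Ioi w, HasDerivAt g (g' x) x
  nonneg : ∀ x ∈ Set.Ioi w, 0 ≤ g x
  le_div : ∀ x ∈ Set.Ioi w, g x ≤ x / w
  deriv_nonneg : ∀ x ∈ Set.Ioi w, 0 ≤ g' x
  deriv_le_one : ∀ x ∈ Set.Ioi w, g' x ≤ 1
  deriv_le : ∀ x ∈ Set.Ioi w, (1 - w / x) * g' x ≤ g x / w
  ge_on_window : ∀ x ∈ Set.Icc (w + 1 / w) (w + 2 / w), 1 / (2 * w ^ 2) ≤ g x

lemma tailProfile_one {w : ℝ} (hw : 2 ≤ w) : TailProfile w (fun _ => 1) (fun _ => 0) where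
  two_le := hw
  measurable := measurable_const
  measurable_deriv := measurable_const
  continuousWithinAt := continuousWithinAt_const
  hasDerivAt x _ := hasDerivAt_const x 1
  nonneg _ _ := zero_le_one
  le_div x hx := by
    rw [le_div_iff₀ (by linarith), one_mul]
    exact (Set.mem_Ioi.1 hx).le
  deriv_nonneg _ _ := le_rfl
  deriv_le_one _ _ := zero_le_one
  deriv_le _ _ := by
    rw [mul_zero]
    positivity
  ge_on_window _ _ := by
    rw [div_le_one (by positivity)]
    nlinarith

lemma tailProfile_log {w : ℝ} (hw : 2 ≤ w) :
    TailProfile w (fun x => Real.log (x / w)) (fun x => 1 / x) := by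
  have hw0 : 0 < w := by linarith
  have hlog : ∀ x ∈ Set.Ioi w, 0 ≤ Real.log (x / w) := fun x hx =>
    Real.log_nonneg ((one_le_div hw0).2 (le_of_lt hx))
  have hxpos : ∀ x ∈ Set.Ioi w, 0 < x := fun x hx => hw0.trans hx
  refine ⟨hw, by fun_prop, by fun_prop, ?_, ?_, hlog, ?_, ?_, ?_, ?_, ?_⟩
  · refine ContinuousAt.continuousWithinAt ?_
    refine ContinuousAt.log (by fun_prop) ?_
    rw [div_self hw0.ne']
    exact one_ne_zero
  · intro x hx
    have hx0 := hxpos x hx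
    have := ((hasDerivAt_id x).div_const w).log (by simp; exact ⟨hx0.ne', hw0.ne'⟩)
    convert! this using 1
    simp
    field_simp
  · intro x hx
    have hx0 := hxpos x hx
    have := Real.log_le_sub_one_of_pos (div_pos hx0 hw0)
    linarith
  · intro x hx
    have := hxpos x hx
    positivity
  · intro x hx
    rw [div_le_one (hxpos x hx)]
    have := Set.mem_Ioi.1 hx
    linarith
  · intro x hx
    have hx0 := hxpos x hx
    have h1 : 1 - w / x ≤ Real.log (x / w) := by
      have := Real.one_sub_inv_le_log_of_pos (div_pos hx0 hw0)
      rwa [inv_div] at this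
    calc (1 - w / x) * (1 / x) ≤ Real.log (x / w) * (1 / x) := by gcongr
      _ ≤ Real.log (x / w) * (1 / w) := by
          have := hlog x hx
          have := Set.mem_Ioi.1 hx
          gcongr
      _ = Real.log (x / w) / w := by ring
  · intro x hx
    have hx1 : w + 1 / w ≤ x := hx.1
    have hx0 : 0 < x := lt_of_lt_of_le (by positivity) hx1
    have h2 : 1 + 1 / w ^ 2 ≤ x / w := by
      rw [le_div_iff₀ hw0]
      calc (1 + 1 / w ^ 2) * w = w + 1 / w := by field_simp
        _ ≤ x := hx1
    have h3 := Real.one_sub_inv_le_log_of_pos (div_pos hx0 hw0)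
    have h4 : (x / w)⁻¹ ≤ (1 + 1 / w ^ 2)⁻¹ := by gcongr
    have h5 : 1 / (2 * w ^ 2) ≤ 1 - (1 + 1 / w ^ 2)⁻¹ := by
      have : 1 - (1 + 1 / w ^ 2)⁻¹ = 1 / (w ^ 2 + 1) := by
        field_simp
        ring
      rw [this]
      apply one_div_le_one_div_of_le (by positivity)
      nlinarith
    linarith

/-- Universal constant in the lower bound for Gaussian tails. -/
noncomputable def tailConst : ℝ := (√(2 * Real.pi))⁻¹ * Real.exp (-4) / 2

lemma tailConst_pos : 0 < tailConst := by
  have := Real.pi_pos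
  unfold tailConst
  positivity

variable {w : ℝ} {g g' : ℝ → ℝ}

namespace TailProfile

lemma pos (h : TailProfile w g g') : 0 < w := by linarith [h.two_le]

lemma measurable_indicator (h : TailProfile w g g') : Measurable ((Set.Ioi w).indicator g) :=
  h.measurable.indicator measurableSet_Ioi

lemma indicator_nonneg (h : TailProfile w g g') (x : ℝ) : 0 ≤ (Set.Ioi w).indicator g x :=
  Set.indicator_nonneg h.nonneg x

lemma indicator_sq_le (h : TailProfile w g g') (x : ℝ) :
    (Set.Ioi w).indicator g x ^ 2 ≤ x * (Set.Ioi w).indicator g x / w := by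
  by_cases hx : x ∈ Set.Ioi w
  · rw [Set.indicator_of_mem hx]
    calc g x ^ 2 = g x * g x := sq _
      _ ≤ (x / w) * g x := by
          have := h.nonneg x hx
          have := h.le_div x hx
          gcongr
      _ = x * g x / w := by ring
  · simp [Set.indicator_of_notMem hx]

lemma abs_indicator_le (h : TailProfile w g g') (x : ℝ) :
    |(Set.Ioi w).indicator g x| ≤ |x| := by
  rw [abs_of_nonneg (h.indicator_nonneg x)]
  by_cases hx : x ∈ Set.Ioi w
  · rw [Set.indicator_of_mem hx]
    have hx' : w < x := hx
    have h0 : 0 < x := h.pos.trans hx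
    refine (h.le_div x hx).trans ((div_le_self h0.le ?_).trans (le_abs_self x))
    linarith [h.two_le]
  · simp [Set.indicator_of_notMem hx]

lemma memLp (h : TailProfile w g g') : MemLp ((Set.Ioi w).indicator g) 2 (gaussianReal 0 1) :=
  memLp_id_two.mono h.measurable_indicator.aestronglyMeasurable
    (ae_of_all _ fun x => by simpa only [Real.norm_eq_abs] using h.abs_indicator_le x)

lemma integrable (h : TailProfile w g g') :
    Integrable ((Set.Ioi w).indicator g) (gaussianReal 0 1) := h.memLp.integrable one_le_two

lemma integrable_id_mul (h : TailProfile w g g') :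
    Integrable (fun x => x * (Set.Ioi w).indicator g x) (gaussianReal 0 1) :=
  memLp_id_two.integrable_mul h.memLp

lemma mul_integral_le (h : TailProfile w g g') :
    w * ∫ x, (Set.Ioi w).indicator g x ∂(gaussianReal 0 1)
      ≤ ∫ x, x * (Set.Ioi w).indicator g x ∂(gaussianReal 0 1) := by
  rw [← integral_const_mul]
  refine integral_mono (h.integrable.const_mul _) h.integrable_id_mul fun x => ?_
  by_cases hx : x ∈ Set.Ioi w
  · have := h.indicator_nonneg x
    have : w < x := hx
    simp only
    gcongr
  · simp [Set.indicator_of_notMem hx]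

lemma integral_id_mul_le (h : TailProfile w g g') :
    ∫ x, x * (Set.Ioi w).indicator g x ∂(gaussianReal 0 1)
      ≤ (w + 2 / w) * ∫ x, (Set.Ioi w).indicator g x ∂(gaussianReal 0 1) := by
  have hw0 := h.pos
  have hw2 := h.two_le
  set φ := gaussianPDFReal 0 1 with hφ
  have hφ0 : ∀ x, 0 ≤ φ x := gaussianPDFReal_nonneg 0 1
  let D : ℝ → ℝ := fun x =>
    (w / x ^ 2 * g x + (1 - w / x) * g' x) * φ x + (1 - w / x) * g x * (-x * φ x)
  have hxpos : ∀ x ∈ Set.Ioi w, 0 < x := fun x hx => hw0.trans hx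
  have hfrac : ∀ x ∈ Set.Ioi w, 0 ≤ 1 - w / x ∧ 1 - w / x ≤ 1 := by
    intro x hx
    have hx0 := hxpos x hx
    have h1 : w / x ≤ 1 := (div_le_one hx0).2 (le_of_lt hx)
    have h2 : 0 ≤ w / x := by positivity
    constructor <;> linarith
  have hsmall : ∀ x ∈ Set.Ioi w, w / x ^ 2 * g x ≤ g x / w := by
    intro x hx
    have hx0 := hxpos x hx
    have hg := h.nonneg x hx
    have hx1 : w < x := hx
    rw [div_eq_mul_inv (g x), mul_comm]
    gcongr
    rw [div_le_iff₀ (by positivity), inv_mul_eq_div, le_div_iff₀ hw0]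
    nlinarith
  have hgx : ∀ x ∈ Set.Ioi w, g x ≤ x := by
    intro x hx
    have hx0 := hxpos x hx
    exact (h.le_div x hx).trans (div_le_self hx0.le (by linarith))
  have hD : ∀ x ∈ Set.Ioi w, HasDerivAt (fun x => (1 - w / x) * g x * φ x) (D x) x := by
    intro x hx
    have hx0 := hxpos x hx
    have h1 : HasDerivAt (fun x : ℝ => 1 - w / x) (w / x ^ 2) x := by
      have := ((hasDerivAt_inv hx0.ne').const_mul w).const_sub 1
      convert! this using 1
      field_simp
    exact (h1.mul (h.hasDerivAt x hx)).mul (hasDerivAt_gaussianPDFReal x)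
  have hDint : IntegrableOn D (Set.Ioi w) := by
    have hb : IntegrableOn (fun x : ℝ => 2 * (x ^ 0 * φ x) + 2 * (x ^ 2 * φ x)) (Set.Ioi w) :=
      (((integrable_pow_mul_gaussianPDFReal 0).const_mul 2).add
        ((integrable_pow_mul_gaussianPDFReal 2).const_mul 2)).integrableOn
    refine hb.mono' ?_ ?_
    · have := h.measurable
      have := h.measurable_deriv
      have := measurable_gaussianPDFReal 0 1
      refine Measurable.aestronglyMeasurable ?_
      simp only [D]
      fun_prop
    · refine (ae_restrict_iff' measurableSet_Ioi).2 (ae_of_all _ fun x hx => ?_)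
      have hx0 := hxpos x hx
      have hx1 : w < x := hx
      obtain ⟨f0, f1⟩ := hfrac x hx
      have hg := h.nonneg x hx
      have hg' := h.deriv_nonneg x hx
      have hg1 := h.deriv_le_one x hx
      have hgx' := hgx x hx
      have s1 := hsmall x hx
      have s0 : 0 ≤ w / x ^ 2 * g x := by positivity
      have s2 : g x / w ≤ x := (div_le_self hg (by linarith)).trans hgx'
      have t1 : 0 ≤ (1 - w / x) * g' x := mul_nonneg f0 hg'
      have t2 : (1 - w / x) * g' x ≤ 1 := mul_le_one₀ f1 hg' hg1
      have u1 : 0 ≤ (1 - w / x) * g x * x := by positivity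
      have u2 : (1 - w / x) * g x * x ≤ x * x := by
        have : (1 - w / x) * g x ≤ 1 * x := mul_le_mul f1 hgx' hg zero_le_one
        nlinarith
      have hDx : D x = (w / x ^ 2 * g x + (1 - w / x) * g' x - (1 - w / x) * g x * x) * φ x := by
        simp only [D]
        ring
      rw [hDx, norm_mul, Real.norm_of_nonneg (hφ0 x), Real.norm_eq_abs]
      have : |w / x ^ 2 * g x + (1 - w / x) * g' x - (1 - w / x) * g x * x| ≤ 2 + 2 * x ^ 2 := by
        rw [abs_le]
        constructor <;> nlinarith
      calc _ ≤ (2 + 2 * x ^ 2) * φ x := mul_le_mul_of_nonneg_right this (hφ0 x)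
        _ = _ := by ring
  have hlim : Tendsto (fun x => (1 - w / x) * g x * φ x) atTop (𝓝 0) := by
    refine squeeze_zero' ?_ ?_ tendsto_mul_gaussianPDFReal
    · filter_upwards [eventually_gt_atTop w] with x hx
      exact mul_nonneg (mul_nonneg (hfrac x hx).1 (h.nonneg x hx)) (hφ0 x)
    · filter_upwards [eventually_gt_atTop w] with x hx
      refine mul_le_mul_of_nonneg_right ?_ (hφ0 x)
      calc (1 - w / x) * g x ≤ 1 * x :=
            mul_le_mul (hfrac x hx).2 (hgx x hx) (h.nonneg x hx) zero_le_one
        _ = x := one_mul x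
  have hcont : ContinuousWithinAt (fun x => (1 - w / x) * g x * φ x) (Set.Ici w) w := by
    refine ContinuousWithinAt.mul (ContinuousWithinAt.mul ?_ h.continuousWithinAt) ?_
    · refine ContinuousAt.continuousWithinAt ?_
      exact continuousAt_const.sub (continuousAt_const.div continuousAt_id hw0.ne')
    · exact (hasDerivAt_gaussianPDFReal w).continuousAt.continuousWithinAt
  have hzero : ∫ x in Set.Ioi w, D x = 0 := by
    rw [integral_Ioi_of_hasDerivAt_of_tendsto hcont hD hDint hlim]
    simp [div_self hw0.ne']
  have e1 : ∀ f : ℝ → ℝ, ∫ x, (Set.Ioi w).indicator f x ∂(gaussianReal 0 1)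
      = ∫ x in Set.Ioi w, φ x * f x := by
    intro f
    rw [integral_gaussianReal_eq_integral_smul one_ne_zero, ← integral_indicator measurableSet_Ioi]
    congr 1
    funext x
    by_cases hx : x ∈ Set.Ioi w <;> simp [hx, hφ]
  have e2 : ∀ x, x * (Set.Ioi w).indicator g x = (Set.Ioi w).indicator (fun x => x * g x) x := by
    intro x
    by_cases hx : x ∈ Set.Ioi w <;> simp [hx]
  have i1 : IntegrableOn (fun x => φ x * g x) (Set.Ioi w) := by
    have := (integrable_gaussianReal_iff one_ne_zero 0 _).1 h.integrable
    refine (this.integrableOn (s := Set.Ioi w)).congr_fun (fun x hx => ?_) measurableSet_Ioi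
    simp [Set.indicator_of_mem hx, hφ]
  have i2 : IntegrableOn (fun x => φ x * (x * g x)) (Set.Ioi w) := by
    have := (integrable_gaussianReal_iff one_ne_zero 0 _).1 h.integrable_id_mul
    refine (this.integrableOn (s := Set.Ioi w)).congr_fun (fun x hx => ?_) measurableSet_Ioi
    simp [Set.indicator_of_mem hx, hφ]
  have key : ∫ x in Set.Ioi w, φ x * (x * g x)
      ≤ ∫ x in Set.Ioi w, ((w + 2 / w) * (φ x * g x) + (-1) * D x) := by
    refine setIntegral_mono_on i2 ((i1.const_mul _).add (hDint.const_mul _)) measurableSet_Ioi ?_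
    intro x hx
    have hx0 := hxpos x hx
    have s1 := hsmall x hx
    have s2 := h.deriv_le x hx
    have : x * g x ≤ (w + 2 / w) * g x
        - (w / x ^ 2 * g x + (1 - w / x) * g' x - (1 - w / x) * g x * x) := by
      have e3 : (1 - w / x) * g x * x = x * g x - w * g x := by
        field_simp
      have e4 : (w + 2 / w) * g x = w * g x + g x / w + g x / w := by ring
      rw [e3, e4]
      linarith
    have h3 := mul_le_mul_of_nonneg_left this (hφ0 x)
    simp only [D]
    nlinarith [h3]
  rw [integral_add (i1.const_mul _) (hDint.const_mul _), integral_const_mul, integral_const_mul,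
    hzero, mul_zero, add_zero] at key
  simp_rw [e2]
  rw [e1, e1]
  exact key

lemma integral_sq_le (h : TailProfile w g g') :
    ∫ x, (Set.Ioi w).indicator g x ^ 2 ∂(gaussianReal 0 1)
      ≤ 2 * ∫ x, (Set.Ioi w).indicator g x ∂(gaussianReal 0 1) := by
  have hw0 := h.pos
  have hw2 := h.two_le
  have hm : 0 ≤ ∫ x, (Set.Ioi w).indicator g x ∂(gaussianReal 0 1) :=
    integral_nonneg h.indicator_nonneg
  calc ∫ x, (Set.Ioi w).indicator g x ^ 2 ∂(gaussianReal 0 1)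
      ≤ ∫ x, x * (Set.Ioi w).indicator g x / w ∂(gaussianReal 0 1) :=
        integral_mono h.memLp.integrable_sq (h.integrable_id_mul.div_const w) h.indicator_sq_le
    _ = (∫ x, x * (Set.Ioi w).indicator g x ∂(gaussianReal 0 1)) / w := integral_div _ _
    _ ≤ ((w + 2 / w) * ∫ x, (Set.Ioi w).indicator g x ∂(gaussianReal 0 1)) / w := by
        have := h.integral_id_mul_le
        gcongr
    _ = (1 + 2 / w ^ 2) * ∫ x, (Set.Ioi w).indicator g x ∂(gaussianReal 0 1) := by
        field_simp
    _ ≤ _ := by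
        gcongr
        have : 2 / w ^ 2 ≤ 1 := by
          rw [div_le_one (by positivity)]
          nlinarith
        linarith

lemma le_integral (h : TailProfile w g g') :
    tailConst * Real.exp (-w ^ 2 / 2) / w ^ 3
      ≤ ∫ x, (Set.Ioi w).indicator g x ∂(gaussianReal 0 1) := by
  have hw0 := h.pos
  have hw2 := h.two_le
  set φ := gaussianPDFReal 0 1 with hφ
  have hφ0 : ∀ x, 0 ≤ φ x := gaussianPDFReal_nonneg 0 1
  rw [integral_gaussianReal_eq_integral_smul one_ne_zero]
  have hi : Integrable (fun x => φ x • (Set.Ioi w).indicator g x) :=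
    (integrable_gaussianReal_iff one_ne_zero 0 _).1 h.integrable
  set K := tailConst * Real.exp (-w ^ 2 / 2) / w ^ 2 with hK
  have hpi := Real.pi_pos
  have h1 : ∀ x ∈ Set.Icc (w + 1 / w) (w + 2 / w), K ≤ φ x • (Set.Ioi w).indicator g x := by
    intro x hx
    have hwx : w < x := lt_of_lt_of_le (by simp [hw0]) hx.1
    rw [Set.indicator_of_mem (Set.mem_Ioi.2 hwx), smul_eq_mul]
    have hg := h.ge_on_window x hx
    have hexp : (√(2 * Real.pi))⁻¹ * (Real.exp (-4) * Real.exp (-w ^ 2 / 2)) ≤ φ x := by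
      rw [hφ, gaussianPDFReal_zero_one, ← Real.exp_add]
      gcongr
      have hx2 : x ^ 2 ≤ (w + 2 / w) ^ 2 := by
        have := hx.2
        have := (hw0.trans hwx).le
        gcongr
      have h4 : (w + 2 / w) ^ 2 = w ^ 2 + 4 + 4 / w ^ 2 := by
        field_simp
        ring
      have h5 : 4 / w ^ 2 ≤ 1 := by
        rw [div_le_one (by positivity)]
        nlinarith
      linarith
    calc K = ((√(2 * Real.pi))⁻¹ * (Real.exp (-4) * Real.exp (-w ^ 2 / 2))) * (1 / (2 * w ^ 2)) := by
          rw [hK, tailConst]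
          field_simp
      _ ≤ φ x * g x := by
          have := hφ0 x
          gcongr
  calc tailConst * Real.exp (-w ^ 2 / 2) / w ^ 3
      = ∫ _ in Set.Icc (w + 1 / w) (w + 2 / w), K := by
        rw [setIntegral_const, Real.volume_real_Icc_of_le (by gcongr; norm_num), smul_eq_mul, hK]
        field_simp
        ring
    _ ≤ ∫ x in Set.Icc (w + 1 / w) (w + 2 / w), φ x • (Set.Ioi w).indicator g x :=
        setIntegral_mono_on (integrableOn_const (by simp)) hi.integrableOn measurableSet_Icc h1
    _ ≤ ∫ x, φ x • (Set.Ioi w).indicator g x :=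
        setIntegral_le_integral hi (ae_of_all _ fun x => mul_nonneg (hφ0 x) (h.indicator_nonneg x))

lemma integral_pos (h : TailProfile w g g') :
    0 < ∫ x, (Set.Ioi w).indicator g x ∂(gaussianReal 0 1) := by
  have := h.pos
  have := tailConst_pos
  exact lt_of_lt_of_le (by positivity) h.le_integral

end TailProfile

end Tail

/-! ### Regularly varying sums -/

section Sums

/-- If `n^{1-s} b n → B` with `s > 0`, then `n^{-s} ∑_{k < n} b k → B / s`. -/
lemma tendsto_sum_range_rpow {s B : ℝ} (hs : 0 < s) {b : ℕ → ℝ}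
    (hb : Tendsto (fun n : ℕ => (n : ℝ) ^ (1 - s) * b n) atTop (𝓝 B)) :
    Tendsto (fun n : ℕ => (n : ℝ) ^ (-s) * ∑ k ∈ Finset.range n, b k) atTop (𝓝 (B / s)) := by
  set g : ℕ → ℝ := fun k => ((k + 1 : ℕ) : ℝ) ^ s - (k : ℝ) ^ s with hg
  have hg0 : 0 ≤ g := by
    intro k
    simp only [hg, Pi.zero_apply, sub_nonneg]
    gcongr
    simp
  have hsum : ∀ n, ∑ k ∈ Finset.range n, g k = (n : ℝ) ^ s := by
    intro n
    rw [hg, Finset.sum_range_sub (fun k : ℕ => (k : ℝ) ^ s)]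
    simp [Real.zero_rpow hs.ne']
  have hglim : Tendsto (fun n : ℕ => (n : ℝ) ^ (1 - s) * g n) atTop (𝓝 s) := by
    have hd : HasDerivAt (fun x : ℝ => x ^ s) s 1 := by
      simpa using Real.hasDerivAt_rpow_const (x := 1) (p := s) (Or.inl one_ne_zero)
    have hd' := hd.tendsto_slope_zero_right
    have hn : Tendsto (fun n : ℕ => (n : ℝ)⁻¹) atTop (𝓝[>] 0) :=
      tendsto_inv_atTop_nhdsGT_zero.comp tendsto_natCast_atTop_atTop
    refine (hd'.comp hn).congr' ?_
    filter_upwards [eventually_gt_atTop 0] with n hn0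
    have hn1 : (0 : ℝ) < n := Nat.cast_pos.2 hn0
    simp only [Function.comp, hg, inv_inv, smul_eq_mul, Real.one_rpow]
    have e1 : (1 + (n : ℝ)⁻¹) = (n + 1) / n := by field_simp
    rw [e1, Real.div_rpow (by positivity) hn1.le, Real.rpow_sub hn1, Real.rpow_one]
    push_cast
    field_simp
  have hlit : (fun n => b n - B / s * g n) =o[atTop] g := by
    have h1 : Tendsto (fun n : ℕ => (n : ℝ) ^ (1 - s) * (b n - B / s * g n)) atTop (𝓝 0) := by
      have := hb.sub (hglim.const_mul (B / s))
      rw [div_mul_cancel₀ _ hs.ne', sub_self] at this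
      refine this.congr fun n => ?_
      ring
    have h2 := h1.div hglim hs.ne'
    rw [zero_div] at h2
    have hgpos : ∀ n, g n ≠ 0 := by
      intro n
      have : (n : ℝ) ^ s < ((n + 1 : ℕ) : ℝ) ^ s := by
        apply Real.rpow_lt_rpow (by positivity) _ hs
        simp
      simp only [hg]
      linarith
    rw [Asymptotics.isLittleO_iff_tendsto fun n hn => absurd hn (hgpos n)]
    refine h2.congr' ?_
    filter_upwards [eventually_gt_atTop 0] with n hn0
    have hn1 : (0 : ℝ) < n := Nat.cast_pos.2 hn0
    have := (Real.rpow_pos_of_pos hn1 (1 - s)).ne'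
    rw [Pi.div_apply, mul_div_mul_left _ _ this]
  have hS := hlit.sum_range hg0 (by
    simp_rw [hsum]
    exact (tendsto_rpow_atTop hs).comp tendsto_natCast_atTop_atTop)
  have hS' := hS.tendsto_div_nhds_zero
  have h3 := hS'.add_const (B / s)
  rw [zero_add] at h3
  refine h3.congr' ?_
  filter_upwards [eventually_gt_atTop 0] with n hn0
  have hn1 : (0 : ℝ) < n := Nat.cast_pos.2 hn0
  have := (Real.rpow_pos_of_pos hn1 s)
  rw [Finset.sum_sub_distrib, ← Finset.mul_sum, hsum, Real.rpow_neg hn1.le]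
  field_simp
  ring

/-- The sum of all entries of the `n × n` Toeplitz matrix with symbol `r`. -/
noncomputable def toeplitzSum (r : ℕ → ℝ) (n : ℕ) : ℝ :=
  ∑ i ∈ Finset.Icc 1 n, ∑ j ∈ Finset.Icc 1 n, r (((i : ℤ) - (j : ℤ)).natAbs)

lemma sum_Icc_natAbs (r : ℕ → ℝ) (n : ℕ) :
    ∑ j ∈ Finset.Icc 1 n, r (((n + 1 : ℕ) : ℤ) - (j : ℤ)).natAbs
      = ∑ k ∈ Finset.range (n + 1), r k - r 0 := by
  rw [Finset.sum_range_succ', add_sub_cancel_right]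
  refine Finset.sum_bij' (fun j _ => n - j) (fun k _ => n - k) ?_ ?_ ?_ ?_ ?_
  · intro j hj
    rw [Finset.mem_Icc] at hj
    rw [Finset.mem_range]
    omega
  · intro k hk
    rw [Finset.mem_range] at hk
    rw [Finset.mem_Icc]
    omega
  · intro j hj
    rw [Finset.mem_Icc] at hj
    omega
  · intro k hk
    rw [Finset.mem_range] at hk
    omega
  · intro j hj
    rw [Finset.mem_Icc] at hj
    congr 1
    omega

lemma toeplitzSum_succ (r : ℕ → ℝ) (n : ℕ) :
    toeplitzSum r (n + 1)
      = toeplitzSum r n + (2 * ∑ k ∈ Finset.range (n + 1), r k - r 0) := by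
  unfold toeplitzSum
  rw [Finset.sum_Icc_succ_top (by omega)]
  simp_rw [Finset.sum_Icc_succ_top (show 1 ≤ n + 1 by omega)]
  rw [Finset.sum_add_distrib, sum_Icc_natAbs]
  have : ∑ i ∈ Finset.Icc 1 n, r ((i : ℤ) - ((n + 1 : ℕ) : ℤ)).natAbs
      = ∑ k ∈ Finset.range (n + 1), r k - r 0 := by
    rw [← sum_Icc_natAbs]
    refine Finset.sum_congr rfl fun i _ => ?_
    congr 1
    omega
  rw [this]
  simp
  ring

lemma toeplitzSum_eq (r : ℕ → ℝ) (n : ℕ) :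
    toeplitzSum r n
      = ∑ m ∈ Finset.range n, (2 * ∑ k ∈ Finset.range (m + 1), r k - r 0) := by
  induction n with
  | zero => simp [toeplitzSum]
  | succ n ih =>
    rw [toeplitzSum_succ, ih]
    exact (Finset.sum_range_succ (fun m => 2 * ∑ k ∈ Finset.range (m + 1), r k - r 0) n).symm

lemma tendsto_toeplitzSum {s B : ℝ} (hs : 0 < s) {r : ℕ → ℝ}
    (hr : Tendsto (fun n : ℕ => (n : ℝ) ^ (1 - s) * r n) atTop (𝓝 B)) :
    Tendsto (fun n : ℕ => (n : ℝ) ^ (-(1 + s)) * toeplitzSum r n) atTop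
      (𝓝 (2 * B / (s * (s + 1)))) := by
  have h1 := tendsto_sum_range_rpow hs hr
  have hz : Tendsto (fun n : ℕ => (n : ℝ) ^ (-s)) atTop (𝓝 0) :=
    (tendsto_rpow_neg_atTop hs).comp tendsto_natCast_atTop_atTop
  have hr0 : Tendsto (fun n : ℕ => (n : ℝ) ^ (-s) * r n) atTop (𝓝 0) := by
    have hi : Tendsto (fun n : ℕ => (n : ℝ)⁻¹) atTop (𝓝 0) := tendsto_inv_atTop_nhds_zero_nat
    have := hi.mul hr
    rw [zero_mul] at this
    refine this.congr' ?_
    filter_upwards [eventually_gt_atTop 0] with n hn0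
    have hn1 : (0 : ℝ) < n := Nat.cast_pos.2 hn0
    rw [show 1 - s = 1 + -s by ring, Real.rpow_add hn1, Real.rpow_one]
    field_simp
  have h2 : Tendsto (fun n : ℕ => (n : ℝ) ^ (1 - (s + 1)) *
      (2 * ∑ k ∈ Finset.range (n + 1), r k - r 0)) atTop (𝓝 (2 * (B / s))) := by
    have := ((h1.add hr0).const_mul 2).sub (hz.mul_const (r 0))
    rw [add_zero, zero_mul, sub_zero] at this
    refine this.congr fun n => ?_
    rw [Finset.sum_range_succ, show 1 - (s + 1) = -s by ring]
    ring
  have h3 := tendsto_sum_range_rpow (by linarith : 0 < s + 1) h2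
  simp_rw [toeplitzSum_eq, add_comm 1 s]
  convert! h3 using 2
  field_simp

end Sums

/-! ### Autocovariances of long memory coefficients -/

section Beta

lemma integrableOn_and_integral_beta {α β : ℝ} (hα : 0 < α) (hβ : 0 < β) :
    IntegrableOn (fun x : ℝ => x ^ (α - 1) * (1 - x) ^ (β - 1)) (Set.Ioo 0 1) ∧
      ∫ x in Set.Ioo (0 : ℝ) 1, x ^ (α - 1) * (1 - x) ^ (β - 1) = beta α β := by
  have hc := Complex.betaIntegral_convergent (u := α) (v := β) (by simpa) (by simpa)
  rw [intervalIntegrable_iff_integrableOn_Ioc_of_le zero_le_one] at hc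
  have e : ∀ x ∈ Set.Ioc (0 : ℝ) 1, ((x : ℂ) ^ ((α : ℂ) - 1) * (1 - (x : ℂ)) ^ ((β : ℂ) - 1)).re
      = x ^ (α - 1) * (1 - x) ^ (β - 1) := by
    intro x hx
    have h1 : (x : ℂ) ^ ((α : ℂ) - 1) * (1 - (x : ℂ)) ^ ((β : ℂ) - 1)
        = ((x ^ (α - 1) * (1 - x) ^ (β - 1) : ℝ) : ℂ) := by
      rw [Complex.ofReal_mul, Complex.ofReal_cpow hx.1.le, Complex.ofReal_cpow (by linarith [hx.2])]
      push_cast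
      rfl
    rw [h1, Complex.ofReal_re]
  have hr : IntegrableOn (fun x : ℝ => x ^ (α - 1) * (1 - x) ^ (β - 1)) (Set.Ioc 0 1) :=
    IntegrableOn.congr_fun hc.re e measurableSet_Ioc
  refine ⟨hr.mono_set Set.Ioo_subset_Ioc_self, ?_⟩
  rw [← integral_Ioc_eq_integral_Ioo, beta_eq_betaIntegralReal α β hα hβ, Complex.betaIntegral,
    intervalIntegral.integral_of_le zero_le_one, ← RCLike.re_to_complex, ← integral_re hc]
  exact (setIntegral_congr_fun measurableSet_Ioc e).symm

lemma image_div_one_add : (fun x : ℝ => x / (1 + x)) '' Set.Ioi 0 = Set.Ioo 0 1 := by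
  ext y
  constructor
  · rintro ⟨x, hx, rfl⟩
    have hx0 : (0 : ℝ) < x := hx
    refine ⟨by positivity, ?_⟩
    rw [div_lt_one (by positivity)]
    linarith
  · rintro ⟨h0, h1⟩
    have h2 : 0 < 1 - y := by linarith
    refine ⟨y / (1 - y), div_pos h0 h2, ?_⟩
    simp only
    field_simp
    ring

/-- The beta integral of the second kind. -/
lemma integrableOn_and_integral_Ioi_beta {d : ℝ} (hd : 0 < d) (hd' : d < 1 / 2) :
    IntegrableOn (fun x : ℝ => x ^ (d - 1) * (1 + x) ^ (d - 1)) (Set.Ioi 0) ∧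
      ∫ x in Set.Ioi (0 : ℝ), x ^ (d - 1) * (1 + x) ^ (d - 1) = beta (1 - 2 * d) d := by
  obtain ⟨h1, h2⟩ := integrableOn_and_integral_beta hd (by linarith : 0 < 1 - 2 * d)
  have hder : ∀ x ∈ Set.Ioi (0 : ℝ),
      HasDerivWithinAt (fun x : ℝ => x / (1 + x)) (1 / (1 + x) ^ 2) (Set.Ioi 0) x := by
    intro x hx
    have hx0 : (0 : ℝ) < x := hx
    have hne : (1 + x) ≠ 0 := by positivity
    have := (hasDerivAt_id x).div ((hasDerivAt_id x).const_add 1) hne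
    convert! this.hasDerivWithinAt using 1
    simp
  have hinj : Set.InjOn (fun x : ℝ => x / (1 + x)) (Set.Ioi 0) := by
    intro x hx y hy hxy
    have hx0 : (0 : ℝ) < x := hx
    have hy0 : (0 : ℝ) < y := hy
    simp only at hxy
    field_simp at hxy
    linarith
  have hcongr : ∀ x ∈ Set.Ioi (0 : ℝ), |1 / (1 + x) ^ 2| •
      ((x / (1 + x)) ^ (d - 1) * (1 - x / (1 + x)) ^ (1 - 2 * d - 1))
      = x ^ (d - 1) * (1 + x) ^ (d - 1) := by
    intro x hx
    have hx0 : (0 : ℝ) < x := hx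
    have h1x : 0 < 1 + x := by positivity
    rw [abs_of_pos (by positivity), smul_eq_mul, Real.div_rpow hx0.le h1x.le,
      show 1 - x / (1 + x) = (1 + x)⁻¹ by field_simp; ring, Real.inv_rpow h1x.le,
      ← Real.rpow_neg h1x.le, one_div, ← Real.rpow_natCast, ← Real.rpow_neg h1x.le,
      div_eq_mul_inv, ← Real.rpow_neg h1x.le]
    have : (1 + x) ^ (d - 1)
        = (1 + x) ^ (-((2 : ℕ) : ℝ)) * (1 + x) ^ (-(d - 1)) * (1 + x) ^ (-(1 - 2 * d - 1)) := by
      rw [← Real.rpow_add h1x, ← Real.rpow_add h1x]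
      congr 1
      push_cast
      ring
    rw [this]
    ring
  constructor
  · rw [← image_div_one_add,
      integrableOn_image_iff_integrableOn_abs_deriv_smul measurableSet_Ioi hder hinj] at h1
    exact h1.congr_fun hcongr measurableSet_Ioi
  · rw [← image_div_one_add,
      integral_image_eq_integral_abs_deriv_smul measurableSet_Ioi hder hinj] at h2
    rw [← setIntegral_congr_fun measurableSet_Ioi hcongr, h2]
    unfold beta
    rw [mul_comm, add_comm]

end Beta

section Floor

lemma iUnion_Ico_natCast : ⋃ n : ℕ, Set.Ico (n : ℝ) (n + 1) = Set.Ici 0 := by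
  ext x
  simp only [Set.mem_iUnion, Set.mem_Ico, Set.mem_Ici]
  constructor
  · rintro ⟨n, h, -⟩
    exact le_trans (Nat.cast_nonneg n) h
  · intro hx
    exact ⟨⌊x⌋₊, Nat.floor_le hx, Nat.lt_floor_add_one x⟩

/-- A summable series is the integral of the corresponding step function. -/
lemma tsum_eq_integral_floor {h : ℕ → ℝ} (hs : Summable fun n => |h n|) :
    ∑' n, h n = ∫ x in Set.Ioi (0 : ℝ), h ⌊x⌋₊ := by
  have hfl : ∀ n : ℕ, ∀ x ∈ Set.Ico (n : ℝ) (n + 1), ⌊x⌋₊ = n := fun n x hx =>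
    (Nat.floor_eq_iff ((Nat.cast_nonneg n).trans hx.1)).2 hx
  have hI : ∀ (f : ℕ → ℝ) (n : ℕ), ∫ x in Set.Ico (n : ℝ) (n + 1), f ⌊x⌋₊ = f n := by
    intro f n
    rw [setIntegral_congr_fun measurableSet_Ico (g := fun _ => f n)
      (fun x hx => by simp only [hfl n x hx]), setIntegral_const]
    simp
  have hint : IntegrableOn (fun x : ℝ => h ⌊x⌋₊) (⋃ n : ℕ, Set.Ico (n : ℝ) (n + 1)) := by
    refine integrableOn_iUnion_of_summable_integral_norm (fun n => ?_) ?_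
    · exact (integrableOn_const (C := h n) (by simp)).congr_fun
        (fun x hx => by simp only [hfl n x hx]) measurableSet_Ico
    · simp_rw [hI (fun n => ‖h n‖), Real.norm_eq_abs]
      exact hs
  rw [← integral_Ici_eq_integral_Ioi, ← iUnion_Ico_natCast,
    integral_iUnion (fun _ => measurableSet_Ico) ?_ hint]
  · simp_rw [hI h]
  · intro m n hmn
    rw [Function.onFun, Set.disjoint_left]
    intro x hx hx'
    exact hmn ((hfl m x hx).symm.trans (hfl n x hx'))

end Floor

/-- The autocovariance at lag `k` of the moving average with coefficients `a` and innovations of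
unit variance. -/
noncomputable def autocov (a : ℕ → ℝ) (k : ℕ) : ℝ := ∑' j, a j * a (j + k)

section Autocov

variable {a : ℕ → ℝ} {c d : ℝ}

lemma tendsto_succ_rpow_mul (ha : Tendsto (fun n : ℕ => (n : ℝ) ^ (1 - d) * a n) atTop (𝓝 c)) :
    Tendsto (fun n : ℕ => ((n : ℝ) + 1) ^ (1 - d) * a n) atTop (𝓝 c) := by
  have h1 : Tendsto (fun n : ℕ => (((n : ℝ) + 1) / n) ^ (1 - d)) atTop (𝓝 1) := by
    have h2 : Tendsto (fun n : ℕ => ((n : ℝ) + 1) / n) atTop (𝓝 1) := by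
      have := (tendsto_inv_atTop_nhds_zero_nat (𝕜 := ℝ)).const_add 1
      rw [add_zero] at this
      refine this.congr' ?_
      filter_upwards [eventually_gt_atTop 0] with n hn
      have : (0 : ℝ) < n := Nat.cast_pos.2 hn
      field_simp
    simpa using h2.rpow_const (p := 1 - d) (Or.inl one_ne_zero)
  have := h1.mul ha
  rw [one_mul] at this
  refine this.congr' ?_
  filter_upwards [eventually_gt_atTop 0] with n hn
  have hn0 : (0 : ℝ) < n := Nat.cast_pos.2 hn
  have := (Real.rpow_pos_of_pos hn0 (1 - d)).ne'
  rw [Real.div_rpow (by positivity) hn0.le]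
  field_simp

lemma exists_abs_coeff_le (ha : Tendsto (fun n : ℕ => (n : ℝ) ^ (1 - d) * a n) atTop (𝓝 c)) :
    ∃ C, 0 < C ∧ ∀ n, |a n| ≤ C * ((n : ℝ) + 1) ^ (d - 1) := by
  obtain ⟨C, hC0, hC⟩ :=
    (Metric.isBounded_range_of_tendsto _ (tendsto_succ_rpow_mul ha)).exists_pos_norm_le
  refine ⟨C, hC0, fun n => ?_⟩
  have h := hC _ ⟨n, rfl⟩
  have hpos : 0 < ((n : ℝ) + 1) ^ (1 - d) := by positivity
  rw [norm_mul, Real.norm_of_nonneg hpos.le, Real.norm_eq_abs] at h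
  rw [show d - 1 = -(1 - d) by ring, Real.rpow_neg (by positivity), ← div_eq_mul_inv,
    le_div_iff₀ hpos]
  linarith

lemma summable_coeff_sq (hd : d < 1 / 2)
    (ha : Tendsto (fun n : ℕ => (n : ℝ) ^ (1 - d) * a n) atTop (𝓝 c)) :
    Summable fun n => a n ^ 2 := by
  obtain ⟨C, hC0, hC⟩ := exists_abs_coeff_le ha
  have hs : Summable fun n : ℕ => C ^ 2 * ((n : ℝ) + 1) ^ (2 * d - 2) := by
    refine Summable.mul_left _ ?_
    have := (Real.summable_nat_rpow (p := 2 * d - 2)).2 (by linarith)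
    have := (summable_nat_add_iff 1).2 this
    refine this.congr fun n => ?_
    push_cast
    rfl
  refine Summable.of_nonneg_of_le (fun n => sq_nonneg _) (fun n => ?_) hs
  rw [← sq_abs]
  calc |a n| ^ 2 ≤ (C * ((n : ℝ) + 1) ^ (d - 1)) ^ 2 := by
        have := hC n
        gcongr
    _ = C ^ 2 * ((n : ℝ) + 1) ^ (2 * d - 2) := by
        rw [mul_pow, ← Real.rpow_natCast (((n : ℝ) + 1) ^ (d - 1)), ← Real.rpow_mul (by positivity)]
        congr 2
        push_cast
        ring

lemma summable_abs_mul_shift (h : Summable fun n => a n ^ 2) (k : ℕ) :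
    Summable fun j => |a j * a (j + k)| := by
  refine Summable.of_nonneg_of_le (fun n => abs_nonneg _) (fun n => ?_)
    (h.add ((summable_nat_add_iff k).2 h))
  rw [abs_mul]
  nlinarith [sq_nonneg (|a n| - |a (n + k)|), sq_abs (a n), sq_abs (a (n + k)),
    abs_nonneg (a n), abs_nonneg (a (n + k))]

lemma tendsto_floor_add_one_div {x : ℝ} (hx : 0 < x) :
    Tendsto (fun k : ℕ => ((⌊(k : ℝ) * x⌋₊ : ℝ) + 1) / k) atTop (𝓝 x) := by
  have h1 := (tendsto_nat_floor_mul_div_atTop hx.le).comp (tendsto_natCast_atTop_atTop (R := ℝ))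
  have h2 := h1.add (tendsto_inv_atTop_nhds_zero_nat (𝕜 := ℝ))
  rw [add_zero] at h2
  refine h2.congr fun k => ?_
  simp only [Function.comp, mul_comm x]
  ring

/-- The autocovariances of a long memory moving average decay like `k^{2d-1}`. -/
theorem tendsto_autocov (hd0 : 0 < d) (hd : d < 1 / 2)
    (ha : Tendsto (fun n : ℕ => (n : ℝ) ^ (1 - d) * a n) atTop (𝓝 c)) :
    Tendsto (fun k : ℕ => (k : ℝ) ^ (1 - 2 * d) * autocov a k) atTop
      (𝓝 (c ^ 2 * beta (1 - 2 * d) d)) := by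
  obtain ⟨C, hC0, hC⟩ := exists_abs_coeff_le ha
  obtain ⟨hbi, hbv⟩ := integrableOn_and_integral_Ioi_beta hd0 hd
  have hsum := summable_coeff_sq hd ha
  have hb := tendsto_succ_rpow_mul ha
  set F : ℕ → ℝ → ℝ := fun k x => (k : ℝ) ^ (1 - d) * a ⌊(k : ℝ) * x⌋₊
    * ((k : ℝ) ^ (1 - d) * a (⌊(k : ℝ) * x⌋₊ + k)) with hF
  have hscale : ∀ k : ℕ, 0 < k →
      (k : ℝ) ^ (1 - 2 * d) * autocov a k = ∫ x in Set.Ioi (0 : ℝ), F k x := by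
    intro k hk
    have hk0 : (0 : ℝ) < k := Nat.cast_pos.2 hk
    have h1 := integral_comp_mul_left_Ioi (fun y : ℝ => a ⌊y⌋₊ * a (⌊y⌋₊ + k)) 0 hk0
    rw [mul_zero, smul_eq_mul,
      ← tsum_eq_integral_floor (h := fun j => a j * a (j + k)) (summable_abs_mul_shift hsum k)] at h1
    have h2 : ∀ x, F k x = ((k : ℝ) ^ (1 - d) * (k : ℝ) ^ (1 - d)) *
        (a ⌊(k : ℝ) * x⌋₊ * a (⌊(k : ℝ) * x⌋₊ + k)) := fun x => by
      simp only [hF]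
      ring
    simp_rw [h2]
    rw [integral_const_mul, h1, ← Real.rpow_add hk0, ← mul_assoc, ← Real.rpow_neg_one,
      ← Real.rpow_add hk0, autocov]
    congr 2
    ring
  have hlim : Tendsto (fun k : ℕ => ∫ x in Set.Ioi (0 : ℝ), F k x) atTop
      (𝓝 (∫ x in Set.Ioi (0 : ℝ), c ^ 2 * (x ^ (d - 1) * (1 + x) ^ (d - 1)))) := by
    refine tendsto_integral_of_dominated_convergence
      (fun x => C ^ 2 * (x ^ (d - 1) * (1 + x) ^ (d - 1))) ?_ (hbi.const_mul _) ?_ ?_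
    · intro k
      refine Measurable.aestronglyMeasurable ?_
      have hfl : Measurable fun x : ℝ => ⌊(k : ℝ) * x⌋₊ :=
        Nat.measurable_floor.comp (measurable_const_mul _)
      exact (((measurable_of_countable a).comp hfl).const_mul _).mul
        (((measurable_of_countable fun j => a (j + k)).comp hfl).const_mul _)
    · intro k
      refine (ae_restrict_iff' measurableSet_Ioi).2 (ae_of_all _ fun x hx => ?_)
      have hx0 : (0 : ℝ) < x := hx
      rcases Nat.eq_zero_or_pos k with rfl | hk
      · simp only [hF, Nat.cast_zero]
        rw [Real.zero_rpow (by linarith)]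
        simp
        positivity
      have hk0 : (0 : ℝ) < k := Nat.cast_pos.2 hk
      have hfl := (Nat.lt_floor_add_one ((k : ℝ) * x)).le
      have hgen : ∀ (m : ℕ) (y : ℝ), 0 < y → (k : ℝ) * y ≤ (m : ℝ) + 1 →
          |(k : ℝ) ^ (1 - d) * a m| ≤ C * y ^ (d - 1) := by
        intro m y hy hm
        have hkp : 0 < (k : ℝ) ^ (1 - d) := by positivity
        rw [abs_mul, abs_of_pos hkp]
        calc (k : ℝ) ^ (1 - d) * |a m| ≤ (k : ℝ) ^ (1 - d) * (C * ((m : ℝ) + 1) ^ (d - 1)) := by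
              have := hC m
              gcongr
          _ ≤ (k : ℝ) ^ (1 - d) * (C * ((k : ℝ) * y) ^ (d - 1)) := by
              have := Real.rpow_le_rpow_of_nonpos (by positivity) hm (by linarith : d - 1 ≤ 0)
              gcongr
          _ = C * y ^ (d - 1) := by
              rw [Real.mul_rpow hk0.le hy.le, show d - 1 = -(1 - d) by ring, Real.rpow_neg hk0.le]
              field_simp
      simp only [hF]
      rw [Real.norm_eq_abs, abs_mul]
      calc _ ≤ (C * x ^ (d - 1)) * (C * (1 + x) ^ (d - 1)) := by
            refine mul_le_mul (hgen _ x hx0 hfl) (hgen _ (1 + x) (by positivity) ?_)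
              (abs_nonneg _) (by positivity)
            push_cast
            linarith
        _ = _ := by ring
    · refine (ae_restrict_iff' measurableSet_Ioi).2 (ae_of_all _ fun x hx => ?_)
      have hx0 : (0 : ℝ) < x := hx
      have hgen : ∀ (m : ℕ → ℕ) (y : ℝ), 0 < y →
          Tendsto (fun k : ℕ => ((m k : ℝ) + 1) / k) atTop (𝓝 y) →
          Tendsto (fun k : ℕ => (k : ℝ) ^ (1 - d) * a (m k)) atTop (𝓝 (c * y ^ (d - 1))) := by
        intro m y hy hm
        have hmt : Tendsto m atTop atTop := by
          have h1 : Tendsto (fun k : ℕ => ((m k : ℝ) + 1) / k * k) atTop atTop :=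
            hm.pos_mul_atTop hy tendsto_natCast_atTop_atTop
          have h2 : Tendsto (fun k : ℕ => ((m k : ℝ) + 1)) atTop atTop := by
            refine h1.congr' ?_
            filter_upwards [eventually_gt_atTop 0] with k hk
            have hk0 : (0 : ℝ) < k := Nat.cast_pos.2 hk
            field_simp
          have h3 : Tendsto (fun k : ℕ => ((m k : ℝ))) atTop atTop := by
            have := tendsto_atTop_add_const_right atTop (-1) h2
            simpa using this
          exact tendsto_natCast_atTop_iff.1 h3
        have h1 := (hb.comp hmt).mul (hm.rpow_const (p := d - 1) (Or.inl hy.ne'))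
        refine h1.congr' ?_
        filter_upwards [eventually_gt_atTop 0] with k hk
        have hk0 : (0 : ℝ) < k := Nat.cast_pos.2 hk
        have hmp : 0 < (m k : ℝ) + 1 := by positivity
        have := (Real.rpow_pos_of_pos hmp (1 - d)).ne'
        simp only [Function.comp]
        rw [Real.div_rpow hmp.le hk0.le, show d - 1 = -(1 - d) by ring, Real.rpow_neg hk0.le,
          Real.rpow_neg hmp.le]
        field_simp
      have t1 := hgen _ x hx0 (tendsto_floor_add_one_div hx0)
      have t2 := hgen (fun k => ⌊(k : ℝ) * x⌋₊ + k) (1 + x) (by positivity) (by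
        have := (tendsto_floor_add_one_div hx0).const_add 1
        refine this.congr' ?_
        filter_upwards [eventually_gt_atTop 0] with k hk
        have hk0 : (0 : ℝ) < k := Nat.cast_pos.2 hk
        push_cast
        field_simp
        ring)
      have t3 := t1.mul t2
      convert! t3 using 2
      ring
  rw [integral_const_mul, hbv] at hlim
  refine hlim.congr' ?_
  filter_upwards [eventually_gt_atTop 0] with k hk
  exact (hscale k hk).symm

end Autocov

/-! ### The Gaussian linear process -/

section Convergence

variable {Ω : Type*} [MeasurableSpace Ω] {P : Measure Ω} [IsProbabilityMeasure P]

lemma ae_exists_tendsto_sum_of_stronglyMeasurable {Y : ℕ → Ω → ℝ}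
    (hm : ∀ n, StronglyMeasurable (Y n)) (hi : iIndepFun Y P) (h2 : ∀ n, MemLp (Y n) 2 P)
    (h0 : ∀ n, ∫ ω, Y n ω ∂P = 0) (hs : Summable fun n => Var[Y n; P]) :
    ∀ᵐ ω ∂P, ∃ l, Tendsto (fun n => ∑ i ∈ Finset.range n, Y i ω) atTop (𝓝 l) := by
  set ℱ := Filtration.natural Y hm with hℱ
  set S : ℕ → Ω → ℝ := fun n => ∑ i ∈ Finset.range (n + 1), Y i with hS
  have hSm : ∀ n, StronglyMeasurable[ℱ n] (S n) := fun n =>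
    Finset.stronglyMeasurable_sum _ fun i hi => by
      have := Filtration.stronglyAdapted_natural hm i
      exact this.mono (ℱ.mono (by rw [Finset.mem_range] at hi; omega))
  have hS2 : ∀ n, MemLp (S n) 2 P := fun n => memLp_finsetSum' _ fun i _ => h2 i
  have hSi : ∀ n, Integrable (S n) P := fun n => (hS2 n).integrable one_le_two
  have hmart : Martingale S ℱ P := by
    refine martingale_nat hSm hSi fun n => ?_
    have e : S (n + 1) = S n + Y (n + 1) := by
      simp only [hS]
      rw [Finset.sum_range_succ _ (n + 1)]
    have h1 := condExp_add (hSi n) ((h2 (n + 1)).integrable one_le_two) (ℱ n)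
    have h3 := iIndepFun.condExp_natural_ae_eq_of_lt hm hi (Nat.lt_succ_self n)
    rw [e]
    filter_upwards [h1, h3] with ω hω hω'
    rw [hω, Pi.add_apply, condExp_of_stronglyMeasurable (ℱ.le n) (hSm n) (hSi n)]
    rw [hℱ, hω', h0, add_zero]
  have hvar : ∀ n, ∫ ω, S n ω ^ 2 ∂P ≤ ∑' i, Var[Y i; P] := by
    intro n
    have hz : ∫ ω, S n ω ∂P = 0 := by
      simp only [hS, Finset.sum_apply]
      rw [integral_finsetSum _ fun i _ => (h2 i).integrable one_le_two]
      simp [h0]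
    have h4 := variance_of_integral_eq_zero (hS2 n).aemeasurable hz
    rw [← h4]
    simp only [hS]
    rw [IndepFun.variance_sum (fun i _ => h2 i) fun i _ j _ hij => hi.indepFun hij]
    exact hs.sum_le_tsum _ fun i _ => variance_nonneg _ _
  have hbdd : ∀ n, eLpNorm (S n) 1 P ≤ ((1 + ∑' i, Var[Y i; P]).toNNReal : ℝ≥0∞) := by
    intro n
    rw [eLpNorm_one_eq_lintegral_enorm, ← ofReal_integral_norm_eq_lintegral_enorm (hSi n)]
    refine ENNReal.ofReal_le_ofReal ?_
    calc ∫ ω, ‖S n ω‖ ∂P ≤ ∫ ω, (1 + S n ω ^ 2) ∂P := by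
          refine integral_mono (hSi n).norm ((integrable_const _).add (hS2 n).integrable_sq) ?_
          intro ω
          simp only [Real.norm_eq_abs]
          nlinarith [sq_abs (S n ω), sq_nonneg (|S n ω| - 1)]
      _ = 1 + ∫ ω, S n ω ^ 2 ∂P := by
          rw [integral_add (integrable_const _) (hS2 n).integrable_sq]
          simp
      _ ≤ _ := by
          gcongr
          exact hvar n
  filter_upwards [hmart.submartingale.ae_tendsto_limitProcess hbdd] with ω hω
  refine ⟨_, (tendsto_add_atTop_iff_nat 1).1 (hω.congr fun n => ?_)⟩
  simp [hS]

/-- A series of independent centered random variables with summable variances converges a.s. -/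
lemma ae_exists_tendsto_sum {Y : ℕ → Ω → ℝ}
    (hi : iIndepFun Y P) (h2 : ∀ n, MemLp (Y n) 2 P)
    (h0 : ∀ n, ∫ ω, Y n ω ∂P = 0) (hs : Summable fun n => Var[Y n; P]) :
    ∀ᵐ ω ∂P, ∃ l, Tendsto (fun n => ∑ i ∈ Finset.range n, Y i ω) atTop (𝓝 l) := by
  set Y' : ℕ → Ω → ℝ := fun n => (h2 n).1.mk (Y n) with hY'
  have hae : ∀ n, Y n =ᵐ[P] Y' n := fun n => (h2 n).1.ae_eq_mk
  have := ae_exists_tendsto_sum_of_stronglyMeasurable (P := P) (Y := Y')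
    (fun n => (h2 n).1.stronglyMeasurable_mk) (hi.congr hae)
    (fun n => (memLp_congr_ae (hae n)).1 (h2 n))
    (fun n => by rw [← integral_congr_ae (hae n), h0])
    (hs.congr fun n => variance_congr (hae n))
  filter_upwards [this, ae_all_iff.2 hae] with ω hω hω'
  simpa only [hω'] using hω

end Convergence

section GaussianLimits

variable {Ω : Type*} [MeasurableSpace Ω] {P : Measure Ω} [IsProbabilityMeasure P]

lemma tendstoInDistribution_gaussianReal {Y : ℕ → Ω → ℝ} {V : ℕ → ℝ≥0} {V₀ : ℝ≥0}
    (hY : ∀ n, HasLaw (Y n) (gaussianReal 0 (V n)) P) (hV : Tendsto V atTop (𝓝 V₀)) :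
    TendstoInDistribution Y atTop (id : ℝ → ℝ) (fun _ => P) (gaussianReal 0 V₀) where
  forall_aemeasurable n := (hY n).aemeasurable
  tendsto := by
    refine ProbabilityMeasure.tendsto_iff_tendsto_charFun.2 fun t => ?_
    simp only [ProbabilityMeasure.coe_mk, (hY _).map_eq, Measure.map_id, charFun_gaussianReal]
    have h1 : Tendsto (fun n => ((V n : ℝ) : ℂ)) atTop (𝓝 ((V₀ : ℝ) : ℂ)) :=
      (Complex.continuous_ofReal.tendsto _).comp ((NNReal.continuous_coe.tendsto _).comp hV)
    exact (Complex.continuous_exp.tendsto _).comp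
      (tendsto_const_nhds.sub ((h1.mul_const _).div_const _))

/-- An almost sure limit of centered Gaussian variables whose variances converge is Gaussian. -/
lemma hasLaw_gaussianReal_of_tendsto {Y : ℕ → Ω → ℝ} {Z : Ω → ℝ} {V : ℕ → ℝ≥0} {V₀ : ℝ≥0}
    (hY : ∀ n, HasLaw (Y n) (gaussianReal 0 (V n)) P) (hV : Tendsto V atTop (𝓝 V₀))
    (hZ : ∀ᵐ ω ∂P, Tendsto (fun n => Y n ω) atTop (𝓝 (Z ω))) :
    HasLaw Z (gaussianReal 0 V₀) P := by
  have hZm : AEMeasurable Z P :=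
    aemeasurable_of_tendsto_metrizable_ae atTop (fun n => (hY n).aemeasurable) hZ
  refine ⟨hZm, ?_⟩
  have := tendstoInDistribution_unique Y
    (tendstoInDistribution_of_ae_tendsto (fun n => (hY n).aemeasurable) hZm hZ)
    (tendstoInDistribution_gaussianReal hY hV)
  rw [this, Measure.map_id]

end GaussianLimits

section LinearProcess

variable {Ω : Type*} [MeasurableSpace Ω] {P : Measure Ω}
  {ε : ℤ → Ω → ℝ} {v : ℝ≥0}

lemma isGaussianProcess_of_iIndepFun (hindep : iIndepFun ε P)
    (hlaw : ∀ t, HasLaw (ε t) (gaussianReal 0 v) P) : IsGaussianProcess ε P where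
  hasGaussianLaw I :=
    (hindep.precomp (g := fun i : I => (i : ℤ)) Subtype.val_injective).hasGaussianLaw
      (fun i => (hlaw i).hasGaussianLaw)

lemma covariance_innovations (hindep : iIndepFun ε P)
    (hlaw : ∀ t, HasLaw (ε t) (gaussianReal 0 v) P) (s t : ℤ) :
    cov[ε s, ε t; P] = if s = t then (v : ℝ) else 0 := by
  split_ifs with h
  · rw [h, covariance_self (hlaw t).aemeasurable, (hlaw t).variance_eq, variance_id_gaussianReal]
  · exact (hindep.indepFun h).covariance_eq_zero (hlaw s).hasGaussianLaw.memLp_two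
      (hlaw t).hasGaussianLaw.memLp_two

/-- Finite linear combinations of i.i.d. centered Gaussian innovations. -/
lemma hasLaw_sum_innovations [IsProbabilityMeasure P] (hindep : iIndepFun ε P)
    (hlaw : ∀ t, HasLaw (ε t) (gaussianReal 0 v) P) {ι : Type*} (T : Finset ι) (b : ι → ℝ)
    (κ : ι → ℤ) :
    HasLaw (fun ω => ∑ p ∈ T, b p * ε (κ p) ω)
      (gaussianReal 0
        (∑ p ∈ T, ∑ q ∈ T, b p * b q * (if κ p = κ q then (v : ℝ) else 0)).toNNReal) P := by
  have hG : HasGaussianLaw (fun ω => ∑ p ∈ T, b p * ε (κ p) ω) P :=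
    (((isGaussianProcess_of_iIndepFun hindep hlaw).comp_right κ).smul b).hasGaussianLaw_fun_sum
  have hL2 : ∀ p, MemLp (fun ω => b p * ε (κ p) ω) 2 P := fun p =>
    ((hlaw (κ p)).hasGaussianLaw.memLp_two).const_mul (b p)
  refine ⟨hG.aemeasurable, ?_⟩
  rw [hG.map_eq_gaussianReal, variance_fun_sum' fun p _ => hL2 p,
    integral_finsetSum _ fun p _ => (hL2 p).integrable one_le_two]
  congr 2
  · refine Finset.sum_eq_zero fun p _ => ?_
    rw [integral_const_mul, (hlaw (κ p)).integral_eq, integral_id_gaussianReal, mul_zero]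
  · refine Finset.sum_congr rfl fun p _ => Finset.sum_congr rfl fun q _ => ?_
    rw [covariance_const_mul_left, covariance_const_mul_right,
      covariance_innovations hindep hlaw]
    ring

/-- Autocovariance of the moving average truncated after `N` terms. -/
noncomputable def truncAutocov (a : ℕ → ℝ) (N : ℕ) (s t : ℤ) : ℝ :=
  ∑ j ∈ Finset.range N, ∑ l ∈ Finset.range N, a j * a l * (if s - j = t - l then 1 else 0)

lemma truncAutocov_comm (a : ℕ → ℝ) (N : ℕ) (s t : ℤ) :
    truncAutocov a N s t = truncAutocov a N t s := by
  unfold truncAutocov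
  rw [Finset.sum_comm]
  refine Finset.sum_congr rfl fun j _ => Finset.sum_congr rfl fun l _ => ?_
  rw [mul_comm (a l)]
  simp only [eq_comm]

lemma truncAutocov_of_ge (a : ℕ → ℝ) (N k : ℕ) (t : ℤ) :
    truncAutocov a N (t + k) t = ∑ l ∈ Finset.range (N - k), a l * a (l + k) := by
  unfold truncAutocov
  rw [Finset.sum_comm]
  have h : ∀ l ∈ Finset.range N, ∑ j ∈ Finset.range N,
      a j * a l * (if t + (k : ℤ) - j = t - l then (1 : ℝ) else 0)
      = if l ∈ Finset.range (N - k) then a l * a (l + k) else 0 := by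
    intro l hl
    have h1 : ∀ j : ℕ, (t + (k : ℤ) - j = t - l) ↔ l + k = j := by
      intro j
      omega
    simp only [h1, mul_ite, mul_one, mul_zero, Finset.sum_ite_eq, Finset.mem_range]
    by_cases hlk : l + k < N
    · rw [if_pos hlk, if_pos (by omega), mul_comm]
    · rw [if_neg hlk, if_neg (by omega)]
  rw [Finset.sum_congr rfl h, ← Finset.sum_filter]
  congr 1
  ext l
  simp only [Finset.mem_filter, Finset.mem_range]
  omega

lemma tendsto_truncAutocov {a : ℕ → ℝ} (ha : Summable fun n => a n ^ 2) (s t : ℤ) :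
    Tendsto (fun N => truncAutocov a N s t) atTop (𝓝 (autocov a (s - t).natAbs)) := by
  have key : ∀ (t : ℤ) (k : ℕ),
      Tendsto (fun N => truncAutocov a N (t + k) t) atTop (𝓝 (autocov a k)) := by
    intro t k
    simp_rw [truncAutocov_of_ge]
    have hs : Summable fun j => a j * a (j + k) := (summable_abs_mul_shift ha k).of_abs
    exact hs.hasSum.tendsto_sum_nat.comp (tendsto_sub_atTop_nat k)
  rcases le_total t s with h | h
  · have := key t (s - t).natAbs
    rwa [show t + ((s - t).natAbs : ℤ) = s by omega] at this
  · have := key s (s - t).natAbs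
    rw [show s + ((s - t).natAbs : ℤ) = t by omega] at this
    simpa only [truncAutocov_comm a _ t s] using this

lemma ae_tendsto_linearProcess [IsProbabilityMeasure P] (hindep : iIndepFun ε P)
    (hlaw : ∀ t, HasLaw (ε t) (gaussianReal 0 v) P) {a : ℕ → ℝ} (ha : Summable fun n => a n ^ 2)
    (t : ℤ) :
    ∀ᵐ ω ∂P, Tendsto (fun N => ∑ j ∈ Finset.range N, a j * ε (t - j) ω) atTop
      (𝓝 (linearProcess a ε t ω)) := by
  have hinj : Function.Injective fun j : ℕ => t - (j : ℤ) := fun i j h => by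
    simp only at h
    omega
  have hL2 : ∀ s, MemLp (ε s) 2 P := fun s => (hlaw s).hasGaussianLaw.memLp_two
  have := ae_exists_tendsto_sum (P := P) (Y := fun (j : ℕ) ω => a j * ε (t - j) ω)
    ((hindep.precomp hinj).comp (fun j x => a j * x) fun j => measurable_const_mul _)
    (fun j => (hL2 _).const_mul (a j))
    (fun j => by
      rw [integral_const_mul, (hlaw _).integral_eq, integral_id_gaussianReal, mul_zero])
    (by
      refine (ha.mul_right (v : ℝ)).congr fun j => ?_
      rw [variance_const_mul, (hlaw _).variance_eq, variance_id_gaussianReal])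
  filter_upwards [this] with ω ⟨l, hl⟩
  rw [linearProcess, hl.limUnder_eq]
  exact hl

/-- Every finite linear combination of the values of the linear process is centered Gaussian. -/
theorem hasLaw_sum_linearProcess [IsProbabilityMeasure P] (hindep : iIndepFun ε P)
    (hlaw : ∀ t, HasLaw (ε t) (gaussianReal 0 v) P) {a : ℕ → ℝ} (ha : Summable fun n => a n ^ 2)
    {ι : Type*} (T : Finset ι) (w : ι → ℝ) (θ : ι → ℤ) :
    HasLaw (fun ω => ∑ i ∈ T, w i * linearProcess a ε (θ i) ω)
      (gaussianReal 0 (v * ∑ i ∈ T, ∑ l ∈ T, w i * w l *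
        autocov a (θ i - θ l).natAbs).toNNReal) P := by
  have hfin : ∀ N : ℕ, HasLaw (fun ω => ∑ i ∈ T, w i * ∑ j ∈ Finset.range N, a j * ε (θ i - j) ω)
      (gaussianReal 0 (v * ∑ i ∈ T, ∑ l ∈ T, w i * w l *
        truncAutocov a N (θ i) (θ l)).toNNReal) P := by
    intro N
    have h := hasLaw_sum_innovations hindep hlaw (T ×ˢ Finset.range N) (fun p => w p.1 * a p.2)
      (fun p => θ p.1 - (p.2 : ℤ))
    simp_rw [Finset.sum_product] at h
    convert! h using 4 with ω
    · rename_i i _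
      rw [Finset.mul_sum]
      refine Finset.sum_congr rfl fun j _ => ?_
      ring
    · rw [Finset.mul_sum]
      refine Finset.sum_congr rfl fun i _ => ?_
      rw [Finset.sum_comm, Finset.mul_sum]
      refine Finset.sum_congr rfl fun l _ => ?_
      rw [truncAutocov, Finset.mul_sum, Finset.mul_sum]
      refine Finset.sum_congr rfl fun j _ => ?_
      rw [Finset.mul_sum, Finset.mul_sum]
      refine Finset.sum_congr rfl fun m _ => ?_
      split_ifs <;> ring
  refine hasLaw_gaussianReal_of_tendsto hfin ?_ ?_
  · refine (continuous_real_toNNReal.tendsto _).comp (Tendsto.const_mul _ ?_)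
    refine tendsto_finsetSum _ fun i _ => tendsto_finsetSum _ fun l _ => ?_
    exact (tendsto_truncAutocov ha _ _).const_mul _
  · have := (Finset.eventually_all T).2 fun i _ =>
      ae_tendsto_linearProcess hindep hlaw ha (θ i)
    filter_upwards [this] with ω hω
    exact tendsto_finsetSum _ fun i hi => (hω i hi).const_mul _

end LinearProcess

/-! ### Covariances of functions of jointly Gaussian variables -/

section Pair

variable {Ω : Type*} [MeasurableSpace Ω] {P : Measure Ω} [IsProbabilityMeasure P]

omit [IsProbabilityMeasure P] in
lemma memLp_comp_of_hasLaw {U : Ω → ℝ} {μ : Measure ℝ} (hU : HasLaw U μ P) {f : ℝ → ℝ}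
    (hf : MemLp f 2 μ) : MemLp (fun ω => f (U ω)) 2 P := by
  have : MemLp f 2 (P.map U) := by rwa [hU.map_eq]
  exact (memLp_map_measure_iff this.1 hU.aemeasurable).1 this

lemma hasLaw_prod_of_combination {U Z : Ω → ℝ} (hU : AEMeasurable U P) (hZ : AEMeasurable Z P)
    (h : ∀ x y : ℝ, HasLaw (fun ω => x * U ω + y * Z ω)
      (gaussianReal 0 (x ^ 2 + y ^ 2).toNNReal) P) :
    HasLaw (fun ω => (U ω, Z ω)) ((gaussianReal 0 1).prod (gaussianReal 0 1)) P := by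
  have hUZ : AEMeasurable (fun ω => (U ω, Z ω)) P := hU.prodMk hZ
  refine ⟨hUZ, ?_⟩
  have := Measure.isProbabilityMeasure_map hUZ
  rw [← charFun_eq_prod_iff]
  intro t
  have hmap : Measure.map (WithLp.toLp 2) (Measure.map (fun ω => (U ω, Z ω)) P)
      = Measure.map (fun ω => WithLp.toLp 2 (U ω, Z ω)) P := by
    rw [AEMeasurable.map_map_of_aemeasurable (by fun_prop) hUZ]
    rfl
  have hc := congrArg (fun μ => charFun μ 1) (h t.ofLp.1 t.ofLp.2).map_eq
  simp only [charFun_gaussianReal] at hc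
  rw [charFun_apply_real, integral_map (h _ _).aemeasurable (by fun_prop)] at hc
  rw [hmap, charFun_apply, integral_map (by fun_prop) (by fun_prop), charFun_gaussianReal,
    charFun_gaussianReal, ← Complex.exp_add]
  simp only [WithLp.prod_inner_apply, RCLike.inner_apply, conj_trivial]
  have e : (((t.ofLp.1 ^ 2 + t.ofLp.2 ^ 2).toNNReal : ℝ) : ℂ)
      = (t.ofLp.1 : ℂ) ^ 2 + (t.ofLp.2 : ℂ) ^ 2 := by
    rw [Real.coe_toNNReal _ (by positivity)]
    push_cast
    rfl
  rw [e] at hc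
  convert! hc using 1
  · refine integral_congr_ae (ae_of_all _ fun ω => ?_)
    simp
  · congr 1
    simp
    ring

/-- Functions without affine part of two standard Gaussian variables with correlation `ρ` have
covariance of order `ρ²`. -/
theorem abs_integral_mul_le_of_correlation {U V : Ω → ℝ} {ρ : ℝ}
    (h : ∀ x y : ℝ, HasLaw (fun ω => x * U ω + y * V ω)
      (gaussianReal 0 (x ^ 2 + y ^ 2 + 2 * x * y * ρ).toNNReal) P)
    {f : ℝ → ℝ} (hfm : Measurable f) (hf : MemLp f 2 (gaussianReal 0 1))
    (h0 : ∫ x, f x ∂(gaussianReal 0 1) = 0) (h1 : ∫ x, x * f x ∂(gaussianReal 0 1) = 0) :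
    |∫ ω, f (U ω) * f (V ω) ∂P| ≤ 4 * ρ ^ 2 * ∫ x, f x ^ 2 ∂(gaussianReal 0 1) := by
  have hU : HasLaw U (gaussianReal 0 1) P := by simpa using h 1 0
  have hV : HasLaw V (gaussianReal 0 1) P := by simpa using h 0 1
  have hfU := memLp_comp_of_hasLaw hU hf
  have hfV := memLp_comp_of_hasLaw hV hf
  set S := ∫ x, f x ^ 2 ∂(gaussianReal 0 1) with hS
  have hS0 : 0 ≤ S := integral_nonneg fun x => sq_nonneg _
  have hSU : ∀ {U : Ω → ℝ}, HasLaw U (gaussianReal 0 1) P → ∫ ω, f (U ω) ^ 2 ∂P = S :=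
    fun hU => hU.integral_comp (f := fun x => f x ^ 2) (hfm.pow_const 2).aestronglyMeasurable
  refine abs_le_of_sq_le_sq ?_ (by positivity)
  rcases le_or_gt (1 / 4) (ρ ^ 2) with hρ | hρ
  · calc (∫ ω, f (U ω) * f (V ω) ∂P) ^ 2
        ≤ (∫ ω, f (U ω) ^ 2 ∂P) * ∫ ω, f (V ω) ^ 2 ∂P := sq_integral_mul_le hfU hfV
      _ = S ^ 2 := by rw [hSU hU, hSU hV, sq]
      _ ≤ (4 * ρ ^ 2 * S) ^ 2 := by
          gcongr
          nlinarith
  · have hρ1 : ρ ^ 2 < 1 := by linarith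
    have hpos : 0 < 1 - ρ ^ 2 := by linarith
    set r := √(1 - ρ ^ 2) with hr
    have hr0 : 0 < r := Real.sqrt_pos.2 hpos
    have hr2 : r ^ 2 = 1 - ρ ^ 2 := Real.sq_sqrt hpos.le
    set Z : Ω → ℝ := fun ω => (V ω - ρ * U ω) / r with hZ
    have hUZ := hasLaw_prod_of_combination (P := P) (U := U) (Z := Z) hU.aemeasurable
      ((hV.aemeasurable.sub (hU.aemeasurable.const_mul ρ)).div_const r) fun x y => by
        have := h (x - y * ρ / r) (y / r)
        convert! this using 2
        · simp only [hZ]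
          field_simp
          ring
        · congr 1
          field_simp
          linear_combination y ^ 2 * hr2
    have hVZ : ∀ ω, V ω = ρ * U ω + r * Z ω := fun ω => by
      simp only [hZ]
      field_simp
      ring
    set F : ℝ × ℝ → ℝ := fun p => f p.1 * f (ρ * p.1 + r * p.2) with hF
    have hFm : Measurable F := by fun_prop
    have hFi : Integrable F ((gaussianReal 0 1).prod (gaussianReal 0 1)) := by
      rw [← hUZ.map_eq, integrable_map_measure hFm.aestronglyMeasurable hUZ.aemeasurable]
      have : Integrable (fun ω => f (U ω) * f (V ω)) P := hfU.integrable_mul hfV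
      refine this.congr (ae_of_all _ fun ω => ?_)
      simp only [Function.comp, hF, ← hVZ]
    have e1 : ∫ ω, f (U ω) * f (V ω) ∂P
        = ∫ p, F p ∂((gaussianReal 0 1).prod (gaussianReal 0 1)) := by
      rw [← hUZ.integral_comp hFm.aestronglyMeasurable]
      refine integral_congr_ae (ae_of_all _ fun ω => ?_)
      simp only [Function.comp, hF, ← hVZ]
    have e2 : ∀ x : ℝ, ∫ z, F (x, z) ∂(gaussianReal 0 1)
        = f x * ∫ y, f y ∂(gaussianReal (ρ * x) (1 - ρ ^ 2).toNNReal) := by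
      intro x
      have hm : gaussianReal (ρ * x) (1 - ρ ^ 2).toNNReal
          = (gaussianReal 0 1).map (fun z => ρ * x + r * z) := by
        have : (fun z => ρ * x + r * z) = (fun z => ρ * x + z) ∘ (fun z => r * z) := rfl
        rw [this, ← Measure.map_map (by fun_prop) (by fun_prop), gaussianReal_map_const_mul,
          gaussianReal_map_const_add]
        congr 1
        · ring
        · ext
          rw [Real.coe_toNNReal _ hpos.le, ← hr2]
          simp
      rw [hm, integral_map (by fun_prop) hfm.aestronglyMeasurable]
      simp only [hF]
      rw [integral_const_mul]
    rw [e1, integral_prod _ hFi]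
    simp_rw [e2]
    refine (sq_integral_mul_mehler_le hρ1 (Real.coe_toNNReal _ hpos.le) hf h0 h1).trans ?_
    have h3 : ρ ^ 4 / (1 - ρ ^ 2) ≤ (4 * ρ ^ 2) ^ 2 := by
      rw [div_le_iff₀ hpos]
      nlinarith [sq_nonneg (ρ ^ 2), sq_nonneg ρ]
    calc S ^ 2 * (ρ ^ 4 / (1 - ρ ^ 2)) ≤ S ^ 2 * (4 * ρ ^ 2) ^ 2 := by gcongr
      _ = (4 * ρ ^ 2 * S) ^ 2 := by ring

/-- Second moment of partial sums of `f (W_t)` where `f` has no affine part. -/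
theorem integral_sum_sq_le {W : ℤ → Ω → ℝ} {ρ : ℕ → ℝ}
    (h : ∀ (s t : ℤ) (x y : ℝ), HasLaw (fun ω => x * W s ω + y * W t ω)
      (gaussianReal 0 (x ^ 2 + y ^ 2 + 2 * x * y * ρ (s - t).natAbs).toNNReal) P)
    {f : ℝ → ℝ} (hfm : Measurable f) (hf : MemLp f 2 (gaussianReal 0 1))
    (h0 : ∫ x, f x ∂(gaussianReal 0 1) = 0) (h1 : ∫ x, x * f x ∂(gaussianReal 0 1) = 0) (n : ℕ) :
    ∫ ω, (∑ t ∈ Finset.Icc 1 n, f (W (t : ℤ) ω)) ^ 2 ∂P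
      ≤ 4 * (∫ x, f x ^ 2 ∂(gaussianReal 0 1)) * toeplitzSum (fun k => ρ k ^ 2) n := by
  have hW : ∀ t, HasLaw (W t) (gaussianReal 0 1) P := fun t => by simpa using h t t 1 0
  have hL2 : ∀ t, MemLp (fun ω => f (W t ω)) 2 P := fun t => memLp_comp_of_hasLaw (hW t) hf
  have hint : ∀ s t, Integrable (fun ω => f (W s ω) * f (W t ω)) P := fun s t =>
    (hL2 s).integrable_mul (hL2 t)
  simp_rw [sq (∑ t ∈ Finset.Icc 1 n, _), Finset.sum_mul_sum]
  rw [integral_finsetSum _ fun s _ => integrable_finsetSum _ fun t _ => hint _ _, toeplitzSum,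
    Finset.mul_sum]
  refine Finset.sum_le_sum fun s _ => ?_
  rw [integral_finsetSum _ fun t _ => hint _ _, Finset.mul_sum]
  refine Finset.sum_le_sum fun t _ => ?_
  refine (le_abs_self _).trans ((abs_integral_mul_le_of_correlation (h s t) hfm hf h0 h1).trans ?_)
  rw [mul_right_comm]

end Pair

/-! ### The limit theorem for tail functionals -/

section TailSums

variable {Ω : Type*} [MeasurableSpace Ω] {P : Measure Ω} [IsProbabilityMeasure P]

omit [IsProbabilityMeasure P] in
lemma tendstoInMeasure_zero_of_integral_sq_le [IsFiniteMeasure P] {B : ℕ → Ω → ℝ} {b : ℕ → ℝ}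
    (hB : ∀ᶠ n in atTop, MemLp (B n) 2 P ∧ ∫ ω, B n ω ^ 2 ∂P ≤ b n)
    (hb : Tendsto b atTop (𝓝 0)) : TendstoInMeasure P B atTop 0 := by
  rw [tendstoInMeasure_iff_measureReal_norm]
  intro r hr
  have h1 : Tendsto (fun n => b n / r ^ 2) atTop (𝓝 0) := by
    simpa using hb.div_const (r ^ 2)
  refine squeeze_zero' (Eventually.of_forall fun n => measureReal_nonneg) ?_ h1
  filter_upwards [hB] with n ⟨hn, hle⟩
  have h2 := mul_meas_ge_le_integral_of_nonneg (ae_of_all _ fun ω => sq_nonneg (B n ω))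
    hn.integrable_sq (r ^ 2)
  have h3 : {ω | r ≤ ‖B n ω - (0 : Ω → ℝ) ω‖} ⊆ {ω | r ^ 2 ≤ B n ω ^ 2} := by
    intro ω hω
    simp only [Set.mem_ofPred_eq, Pi.zero_apply, sub_zero, Real.norm_eq_abs] at hω ⊢
    rw [← sq_abs (B n ω)]
    gcongr
  rw [le_div_iff₀ (by positivity), mul_comm]
  refine le_trans ?_ (h2.trans hle)
  have := measureReal_mono (μ := P) h3
  gcongr

lemma TailProfile.centered {w : ℝ} {g g' : ℝ → ℝ} (h : TailProfile w g g') {f : ℝ → ℝ}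
    (hf : f = fun x => (Set.Ioi w).indicator g x
      - ∫ y, (Set.Ioi w).indicator g y ∂(gaussianReal 0 1)
      - (∫ y, y * (Set.Ioi w).indicator g y ∂(gaussianReal 0 1)) * x) :
    Measurable f ∧ MemLp f 2 (gaussianReal 0 1) ∧ ∫ x, f x ∂(gaussianReal 0 1) = 0 ∧
      ∫ x, x * f x ∂(gaussianReal 0 1) = 0 ∧
      ∫ x, f x ^ 2 ∂(gaussianReal 0 1)
        ≤ 2 * ∫ x, (Set.Ioi w).indicator g x ∂(gaussianReal 0 1) := by
  set G := (Set.Ioi w).indicator g with hG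
  set m := ∫ y, G y ∂(gaussianReal 0 1) with hm
  set l := ∫ y, y * G y ∂(gaussianReal 0 1) with hl
  have hGm : Measurable G := h.measurable_indicator
  have hG2 : MemLp G 2 (gaussianReal 0 1) := h.memLp
  have hfL : MemLp f 2 (gaussianReal 0 1) := by
    rw [hf]
    exact (hG2.sub (memLp_const m)).sub (memLp_id_two.const_mul l)
  have iG : Integrable G (gaussianReal 0 1) := h.integrable
  have ixG : Integrable (fun x => x * G x) (gaussianReal 0 1) := h.integrable_id_mul
  have ix : Integrable (fun x : ℝ => x) (gaussianReal 0 1) := memLp_id_two.integrable one_le_two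
  have ix2 : Integrable (fun x : ℝ => x ^ 2) (gaussianReal 0 1) := memLp_id_two.integrable_sq
  have if1 : Integrable f (gaussianReal 0 1) := hfL.integrable one_le_two
  have ixf : Integrable (fun x => x * f x) (gaussianReal 0 1) := memLp_id_two.integrable_mul hfL
  have iGf : Integrable (fun x => G x * f x) (gaussianReal 0 1) := hG2.integrable_mul hfL
  have h0 : ∫ x, f x ∂(gaussianReal 0 1) = 0 := by
    have i1 : Integrable (fun x => G x - m) (gaussianReal 0 1) := iG.sub (integrable_const m)
    rw [hf, integral_sub i1 (ix.const_mul l), integral_sub iG (integrable_const m),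
      integral_const_mul, integral_id_gaussianReal]
    simp [hm]
  have h1 : ∫ x, x * f x ∂(gaussianReal 0 1) = 0 := by
    have e : ∀ x, x * f x = x * G x - m * x - l * x ^ 2 := fun x => by
      rw [hf]
      ring
    have i1 : Integrable (fun x => x * G x - m * x) (gaussianReal 0 1) := ixG.sub (ix.const_mul m)
    simp_rw [e]
    rw [integral_sub i1 (ix2.const_mul l), integral_sub ixG (ix.const_mul m),
      integral_const_mul, integral_const_mul, integral_id_gaussianReal, integral_sq_gaussianReal]
    simp [hl]
  refine ⟨by rw [hf]; fun_prop, hfL, h0, h1, ?_⟩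
  have e1 : ∫ x, f x ^ 2 ∂(gaussianReal 0 1) = ∫ x, G x * f x ∂(gaussianReal 0 1) := by
    have e : ∀ x, f x ^ 2 = G x * f x - m * f x - l * (x * f x) := fun x => by
      have : f x = G x - m - l * x := by rw [hf]
      rw [sq]
      nth_rewrite 1 [this]
      ring
    have i1 : Integrable (fun x => G x * f x - m * f x) (gaussianReal 0 1) :=
      iGf.sub (if1.const_mul m)
    simp_rw [e]
    rw [integral_sub i1 (ixf.const_mul l), integral_sub iGf (if1.const_mul m),
      integral_const_mul, integral_const_mul, h0, h1]
    ring
  have e2 : ∫ x, G x * f x ∂(gaussianReal 0 1)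
      = ∫ x, G x ^ 2 ∂(gaussianReal 0 1) - m * m - l * l := by
    have e : ∀ x, G x * f x = G x ^ 2 - m * G x - l * (x * G x) := fun x => by
      rw [hf]
      ring
    have i1 : Integrable (fun x => G x ^ 2 - m * G x) (gaussianReal 0 1) :=
      hG2.integrable_sq.sub (iG.const_mul m)
    simp_rw [e]
    rw [integral_sub i1 (ixG.const_mul l), integral_sub hG2.integrable_sq (iG.const_mul m),
      integral_const_mul, integral_const_mul]
  rw [e1, e2]
  have := h.integral_sq_le
  nlinarith [mul_self_nonneg m, mul_self_nonneg l]

lemma tendsto_rpow_neg_mul_log_add {κ β : ℝ} (hκ : 0 < κ) {e : ℕ → ℝ} (he : Tendsto e atTop (𝓝 0)) :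
    Tendsto (fun n : ℕ => (n : ℝ) ^ (-κ) * (2 * β * Real.log n + e n)) atTop (𝓝 0) := by
  have h1 : Tendsto (fun n : ℕ => Real.log n / (n : ℝ) ^ κ) atTop (𝓝 0) :=
    (isLittleO_log_rpow_atTop hκ).tendsto_div_nhds_zero.comp tendsto_natCast_atTop_atTop
  have h2 : Tendsto (fun n : ℕ => (n : ℝ) ^ (-κ)) atTop (𝓝 0) :=
    (tendsto_rpow_neg_atTop hκ).comp tendsto_natCast_atTop_atTop
  have h3 := (h1.const_mul (2 * β)).add (h2.mul he)
  simp only [mul_zero, add_zero] at h3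
  refine h3.congr fun n => ?_
  rw [Real.rpow_neg (Nat.cast_nonneg n)]
  ring

/-- The remainder after removing the linear part of a tail functional is negligible. -/
lemma tendsto_remainder_bound {d θ β K τ : ℝ} (hβ : β + θ < 2 * d) {w e T : ℕ → ℝ}
    (he : Tendsto e atTop (𝓝 0)) (hw : Tendsto w atTop atTop)
    (hwe : ∀ᶠ n : ℕ in atTop, w n ^ 2 = 2 * β * Real.log n + e n)
    (hT0 : ∀ n, 0 ≤ T n) (hK : 0 ≤ K)
    (hT : Tendsto (fun n : ℕ => (n : ℝ) ^ (-(1 + θ)) * T n) atTop (𝓝 0)) :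
    Tendsto (fun n : ℕ => K * ((n : ℝ) ^ (-(1 / 2 + d)) * τ) ^ 2 * T n
      * (w n * Real.exp (w n ^ 2 / 2))) atTop (𝓝 0) := by
  have hκ : 0 < 2 * d - θ - β := by linarith
  have h1 := tendsto_rpow_neg_mul_log_add (β := β) hκ he
  have h2 : Tendsto (fun n => Real.exp (e n / 2)) atTop (𝓝 1) := by
    have := (Real.continuous_exp.tendsto _).comp (he.div_const 2)
    simpa [Function.comp_def] using this
  have h3 := (((hT.mul h1).mul h2).const_mul (K * τ ^ 2))
  simp only [mul_zero, zero_mul] at h3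
  refine squeeze_zero' ?_ ?_ h3
  · filter_upwards [hw.eventually_ge_atTop 1] with n hn
    have := hT0 n
    positivity
  · filter_upwards [hw.eventually_ge_atTop 1, hwe, eventually_gt_atTop 0] with n hn hn2 hn0
    have hn1 : (0 : ℝ) < n := Nat.cast_pos.2 hn0
    have hww : w n ≤ w n ^ 2 := by nlinarith
    have hexp : Real.exp (w n ^ 2 / 2) = (n : ℝ) ^ β * Real.exp (e n / 2) := by
      rw [Real.rpow_def_of_pos hn1, ← Real.exp_add, hn2]
      congr 1
      ring
    have hT0n := hT0 n
    have hpow : ((n : ℝ) ^ (-(1 / 2 + d))) ^ 2 * (n : ℝ) ^ β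
        = (n : ℝ) ^ (-(1 + θ)) * (n : ℝ) ^ (-(2 * d - θ - β)) := by
      rw [← Real.rpow_natCast ((n : ℝ) ^ (-(1 / 2 + d))), ← Real.rpow_mul hn1.le,
        ← Real.rpow_add hn1, ← Real.rpow_add hn1]
      congr 1
      push_cast
      ring
    calc K * ((n : ℝ) ^ (-(1 / 2 + d)) * τ) ^ 2 * T n * (w n * Real.exp (w n ^ 2 / 2))
        ≤ K * ((n : ℝ) ^ (-(1 / 2 + d)) * τ) ^ 2 * T n * (w n ^ 2 * Real.exp (w n ^ 2 / 2)) := by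
          gcongr
      _ = K * τ ^ 2 * (((n : ℝ) ^ (-(1 / 2 + d))) ^ 2 * (n : ℝ) ^ β) * T n * w n ^ 2
          * Real.exp (e n / 2) := by
          rw [hexp]
          ring
      _ = _ := by
          rw [hpow, hn2]
          ring

/-- **Limit theorem for tail functionals.** For a stationary standard Gaussian sequence with long
memory, normalized sums of `g_n(W_t) 1{W_t > w_n}` are asymptotically equivalent to a multiple of
`∑ W_t`. -/
theorem tendstoInDistribution_tail_sum {W : ℤ → Ω → ℝ} {ρ : ℕ → ℝ}
    (hpair : ∀ (s t : ℤ) (x y : ℝ), HasLaw (fun ω => x * W s ω + y * W t ω)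
      (gaussianReal 0 (x ^ 2 + y ^ 2 + 2 * x * y * ρ (s - t).natAbs).toNNReal) P)
    (hsum : ∀ n : ℕ, HasLaw (fun ω => ∑ t ∈ Finset.Icc 1 n, W (t : ℤ) ω)
      (gaussianReal 0 (toeplitzSum ρ n).toNNReal) P)
    {d θ β τ σ2 : ℝ} (hθ : 0 < θ) (hβ : β + θ < 2 * d)
    (hvar : Tendsto (fun n : ℕ => (n : ℝ) ^ (-(1 + 2 * d)) * (τ ^ 2 * toeplitzSum ρ n)) atTop
      (𝓝 σ2))
    (hρ : Tendsto (fun n : ℕ => (n : ℝ) ^ (1 - θ) * ρ n ^ 2) atTop (𝓝 0))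
    {w e : ℕ → ℝ} (he : Tendsto e atTop (𝓝 0)) (hw : Tendsto w atTop atTop)
    (hwe : ∀ᶠ n : ℕ in atTop, w n ^ 2 = 2 * β * Real.log n + e n)
    {g g' : ℕ → ℝ → ℝ} (hgm : ∀ n, Measurable (g n))
    (hg : ∀ᶠ n in atTop, TailProfile (w n) (g n) (g' n)) :
    TendstoInDistribution (fun (n : ℕ) ω => (n : ℝ) ^ (1 / 2 - d) * τ / w n *
      ((∑ t ∈ Finset.Icc 1 n, (Set.Ioi (w n)).indicator (g n) (W (t : ℤ) ω)) /
        (n * ∫ x, (Set.Ioi (w n)).indicator (g n) x ∂(gaussianReal 0 1)) - 1))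
      atTop (id : ℝ → ℝ) (fun _ => P) (gaussianReal 0 σ2.toNNReal) := by
  have hW : ∀ t, HasLaw (W t) (gaussianReal 0 1) P := fun t => by simpa using hpair t t 1 0
  set G : ℕ → ℝ → ℝ := fun n => (Set.Ioi (w n)).indicator (g n) with hG
  set m : ℕ → ℝ := fun n => ∫ x, G n x ∂(gaussianReal 0 1) with hm
  set l : ℕ → ℝ := fun n => ∫ x, x * G n x ∂(gaussianReal 0 1) with hl
  have hGm : ∀ n, Measurable (G n) := fun n => (hgm n).indicator measurableSet_Ioi
  set κ : ℕ → ℝ := fun n => l n / (w n * m n) with hκ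
  have hκ1 : Tendsto κ atTop (𝓝 1) := by
    have hlim : Tendsto (fun n => 1 + 2 / w n ^ 2) atTop (𝓝 1) := by
      have : Tendsto (fun n => w n ^ 2) atTop atTop :=
        (tendsto_pow_atTop (two_ne_zero)).comp hw
      simpa using (this.const_div_atTop 2).const_add 1
    refine tendsto_of_tendsto_of_tendsto_of_le_of_le' tendsto_const_nhds hlim ?_ ?_
    · filter_upwards [hg] with n hn
      simp only [hκ]
      rw [le_div_iff₀ (mul_pos hn.pos hn.integral_pos), one_mul]
      exact hn.mul_integral_le
    · filter_upwards [hg] with n hn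
      have hwn := hn.pos
      simp only [hκ]
      rw [div_le_iff₀ (mul_pos hn.pos hn.integral_pos)]
      refine hn.integral_id_mul_le.trans (le_of_eq ?_)
      field_simp
  set A : ℕ → Ω → ℝ := fun n ω =>
    ((n : ℝ) ^ (-(1 / 2 + d)) * τ * κ n) * ∑ t ∈ Finset.Icc 1 n, W (t : ℤ) ω with hA
  set Y : ℕ → Ω → ℝ := fun (n : ℕ) ω => (n : ℝ) ^ (1 / 2 - d) * τ / w n *
      ((∑ t ∈ Finset.Icc 1 n, G n (W (t : ℤ) ω)) / (n * m n) - 1) with hY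
  have hYm : ∀ n, AEMeasurable (Y n) P := by
    intro n
    have : AEMeasurable (fun ω => ∑ t ∈ Finset.Icc 1 n, G n (W (t : ℤ) ω)) P :=
      Finset.aemeasurable_fun_sum _ fun t _ => (hGm n).comp_aemeasurable (hW t).aemeasurable
    exact ((this.div_const _).sub_const 1).const_mul _
  have hAlaw : ∀ n, HasLaw (A n) (gaussianReal 0
      (((n : ℝ) ^ (-(1 / 2 + d)) * τ * κ n) ^ 2 * toeplitzSum ρ n).toNNReal) P := by
    intro n
    have := gaussianReal_const_mul (hsum n) ((n : ℝ) ^ (-(1 / 2 + d)) * τ * κ n)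
    convert! this using 2
    · simp
    · rw [Real.toNNReal_mul (sq_nonneg _), Real.toNNReal_of_nonneg (sq_nonneg _)]
  have hAlim : TendstoInDistribution A atTop (id : ℝ → ℝ) (fun _ => P)
      (gaussianReal 0 σ2.toNNReal) := by
    refine tendstoInDistribution_gaussianReal hAlaw ((continuous_real_toNNReal.tendsto _).comp ?_)
    have := hvar.mul (hκ1.pow 2)
    rw [one_pow, mul_one] at this
    refine this.congr' ?_
    filter_upwards [eventually_gt_atTop 0] with n hn0
    have hn1 : (0 : ℝ) < n := Nat.cast_pos.2 hn0
    have : (n : ℝ) ^ (-(1 + 2 * d)) = ((n : ℝ) ^ (-(1 / 2 + d))) ^ 2 := by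
      rw [← Real.rpow_natCast ((n : ℝ) ^ (-(1 / 2 + d))), ← Real.rpow_mul hn1.le]
      congr 1
      push_cast
      ring
    rw [this]
    ring
  refine tendstoInDistribution_of_tendstoInMeasure_sub Y id hAlim ?_ hYm
  have hT := tendsto_toeplitzSum hθ hρ
  rw [mul_zero, zero_div] at hT
  have hT0 : ∀ n, 0 ≤ toeplitzSum (fun k => ρ k ^ 2) n := fun n =>
    Finset.sum_nonneg fun i _ => Finset.sum_nonneg fun j _ => sq_nonneg _
  have htc := tailConst_pos
  refine tendstoInMeasure_zero_of_integral_sq_le ?_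
    (tendsto_remainder_bound (K := 8 / tailConst) (τ := τ) hβ he hw hwe hT0 (by positivity) hT)
  filter_upwards [hg, eventually_gt_atTop 0] with n hn hn0
  have hn1 : (0 : ℝ) < n := Nat.cast_pos.2 hn0
  have hwn := hn.pos
  have hmn : 0 < m n := hn.integral_pos
  obtain ⟨fm, fL, f0, f1, f2⟩ := hn.centered rfl
  set f : ℝ → ℝ := fun x => G n x - m n - l n * x with hf
  have hdiff : (Y - A) n = fun ω => ((n : ℝ) ^ (-(1 / 2 + d)) * τ / (w n * m n)) *
      ∑ t ∈ Finset.Icc 1 n, f (W (t : ℤ) ω) := by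
    funext ω
    have e1 : ∑ t ∈ Finset.Icc 1 n, f (W (t : ℤ) ω) = ∑ t ∈ Finset.Icc 1 n, G n (W (t : ℤ) ω)
        - n * m n - l n * ∑ t ∈ Finset.Icc 1 n, W (t : ℤ) ω := by
      simp only [hf]
      rw [Finset.sum_sub_distrib, Finset.sum_sub_distrib, Finset.mul_sum]
      simp
    have e2 : (n : ℝ) ^ (1 / 2 - d) = (n : ℝ) ^ (-(1 / 2 + d)) * n := by
      nth_rewrite 3 [← Real.rpow_one (n : ℝ)]
      rw [← Real.rpow_add hn1]
      congr 1
      ring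
    rw [e1]
    simp only [Pi.sub_apply, hY, hA, hκ]
    rw [e2]
    field_simp
  have hL2 : MemLp (fun ω => ∑ t ∈ Finset.Icc 1 n, f (W (t : ℤ) ω)) 2 P :=
    memLp_finsetSum _ fun t _ => memLp_comp_of_hasLaw (hW t) fL
  refine ⟨by rw [hdiff]; exact hL2.const_mul _, ?_⟩
  rw [hdiff]
  simp_rw [mul_pow _ (∑ t ∈ Finset.Icc 1 n, f (W (t : ℤ) _))]
  rw [integral_const_mul]
  have hmain := integral_sum_sq_le hpair fm fL f0 f1 n
  have hTn := hT0 n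
  have hinv : 1 / m n ≤ w n ^ 3 * Real.exp (w n ^ 2 / 2) / tailConst := by
    have h5 := hn.le_integral
    have h6 : 0 < tailConst * Real.exp (-w n ^ 2 / 2) / w n ^ 3 := by positivity
    refine (one_div_le_one_div_of_le h6 h5).trans (le_of_eq ?_)
    rw [neg_div, Real.exp_neg]
    field_simp
  calc _ ≤ ((n : ℝ) ^ (-(1 / 2 + d)) * τ / (w n * m n)) ^ 2 *
        (4 * (2 * m n) * toeplitzSum (fun k => ρ k ^ 2) n) := by
        gcongr
        refine hmain.trans ?_
        gcongr
    _ = 8 * ((n : ℝ) ^ (-(1 / 2 + d)) * τ) ^ 2 * toeplitzSum (fun k => ρ k ^ 2) n / w n ^ 2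
        * (1 / m n) := by
        field_simp
        ring
    _ ≤ 8 * ((n : ℝ) ^ (-(1 / 2 + d)) * τ) ^ 2 * toeplitzSum (fun k => ρ k ^ 2) n / w n ^ 2
        * (w n ^ 3 * Real.exp (w n ^ 2 / 2) / tailConst) := by
        gcongr
    _ = _ := by
        field_simp

end TailSums

/-! ### Application to the linear process -/

section Application

lemma LongMemory.lt_half {Ω : Type*} [MeasurableSpace Ω] {P : Measure Ω} {a : ℕ → ℝ} {Y : Ω → ℝ}
    {d c : ℝ} (h : LongMemory a Y P d c) : d < 1 / 2 := by
  have h1 := h.d_lt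
  have hmin : (1 : ℝ≥0∞) < min 2 (momentIndex Y P) := lt_min (by norm_num) h.one_lt_momentIndex
  have htop : min 2 (momentIndex Y P) ≠ ∞ := ne_top_of_le_ne_top (by simp) (min_le_left _ _)
  have hα1 : 1 < stabilityIndex Y P := by
    have := (ENNReal.toReal_lt_toReal (by simp) htop).2 hmin
    simpa [stabilityIndex] using this
  have hα2 : stabilityIndex Y P ≤ 2 := by
    have := ENNReal.toReal_mono (by simp) (min_le_left 2 (momentIndex Y P))
    simpa [stabilityIndex] using this
  have : 1 / 2 ≤ 1 / stabilityIndex Y P := one_div_le_one_div_of_le (by linarith) hα2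
  linarith

lemma half_sub_le_kappaZero {d : ℝ} (hd0 : 0 < d) (hd : d < 1 / 2) :
    1 / 2 - d ≤ kappaZero 2 d ∧ 3 * d - 1 / 2 ≤ kappaZero 2 d := by
  unfold kappaZero
  have h1 : 0 < 1 - d := by linarith
  have h2 : 0 < 1 - 2 * d := by linarith
  split_ifs with h
  · constructor <;> rw [le_div_iff₀ (by positivity)] <;> nlinarith
  · have h3 : 2 * ((1 - d) * (1 - 2 * d)) ≤ 1 := by
      rw [not_lt, le_div_iff₀ (by positivity)] at h
      exact h
    constructor <;> rw [le_div_iff₀ (by positivity)] <;> nlinarith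

lemma autocov_zero_pos {a : ℕ → ℝ} {c d : ℝ} (hc : c ≠ 0)
    (hs : Summable fun n => a n ^ 2)
    (ha : Tendsto (fun n : ℕ => (n : ℝ) ^ (1 - d) * a n) atTop (𝓝 c)) : 0 < autocov a 0 := by
  have hne : ∃ n, a n ≠ 0 := by
    by_contra! h
    simp only [h, mul_zero] at ha
    exact hc (tendsto_nhds_unique ha tendsto_const_nhds)
  obtain ⟨n, hn⟩ := hne
  have e : autocov a 0 = ∑' n, a n ^ 2 := by
    unfold autocov
    refine tsum_congr fun j => ?_
    rw [add_zero, sq]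
  rw [e]
  exact hs.tsum_pos (fun n => sq_nonneg _) n (by positivity)

lemma tendstoInDistribution_congr_eventually {Ω Ω' : Type*} [MeasurableSpace Ω]
    [MeasurableSpace Ω'] {P : Measure Ω} [IsProbabilityMeasure P] {μ : Measure Ω'}
    [IsProbabilityMeasure μ] {X Y : ℕ → Ω → ℝ} {Z : Ω' → ℝ}
    (h : TendstoInDistribution X atTop Z (fun _ => P) μ) (hY : ∀ n, AEMeasurable (Y n) P)
    (hXY : ∀ᶠ n in atTop, X n = Y n) : TendstoInDistribution Y atTop Z (fun _ => P) μ := by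
  refine ⟨hY, h.aemeasurable_limit, h.tendsto.congr' ?_⟩
  filter_upwards [hXY] with n hn
  apply Subtype.ext
  simp only [hn]

lemma integral_sq_of_hasLaw {Ω : Type*} [MeasurableSpace Ω] {P : Measure Ω} {Y : Ω → ℝ} {v : ℝ≥0}
    (hY : HasLaw Y (gaussianReal 0 v) P) : ∫ ω, Y ω ^ 2 ∂P = v := by
  have h0 : ∫ ω, Y ω ∂P = 0 := by rw [hY.integral_eq, integral_id_gaussianReal]
  rw [← variance_of_integral_eq_zero hY.aemeasurable h0, hY.variance_eq, variance_id_gaussianReal]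

variable {Ω : Type*} [MeasurableSpace Ω] {P : Measure Ω}

lemma tailProb_eq {X : ℤ → Ω → ℝ} {τ u : ℝ} (hτ : 0 < τ)
    (hW : HasLaw (fun ω => X 0 ω / τ) (gaussianReal 0 1) P) :
    tailProb X P u = ∫ x, (Set.Ioi (u / τ)).indicator (fun _ => 1) x ∂(gaussianReal 0 1) := by
  rw [integral_indicator measurableSet_Ioi, setIntegral_const, smul_eq_mul, mul_one, tailProb]
  have := hW.measureReal_eq (p := fun x => u / τ < x) measurableSet_Ioi
  simp only [div_lt_div_iff_of_pos_right hτ] at this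
  exact this

lemma meanLogExcess_eq {X : ℤ → Ω → ℝ} {τ u : ℝ} (hτ : 0 < τ)
    (hW : HasLaw (fun ω => X 0 ω / τ) (gaussianReal 0 1) P) :
    meanLogExcess X P u
      = (∫ x, (Set.Ioi (u / τ)).indicator (fun x => Real.log (x / (u / τ))) x
          ∂(gaussianReal 0 1)) / tailProb X P u := by
  have hnull : NullMeasurableSet {ω | u < X 0 ω} P := by
    have h1 : {ω | u < X 0 ω} = (fun ω => X 0 ω / τ) ⁻¹' Set.Ioi (u / τ) := by
      ext ω
      simp [div_lt_div_iff_of_pos_right hτ]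
    rw [h1]
    exact hW.aemeasurable.nullMeasurable measurableSet_Ioi
  have hm : Measurable ((Set.Ioi (u / τ)).indicator (fun x => Real.log (x / (u / τ)))) :=
    Measurable.indicator (by fun_prop) measurableSet_Ioi
  rw [meanLogExcess, ProbabilityTheory.cond, integral_smul_measure, ENNReal.toReal_inv, smul_eq_mul,
    ← hW.integral_comp hm.aestronglyMeasurable, ← integral_indicator₀ hnull, tailProb,
    measureReal_def, inv_mul_eq_div]
  congr 1
  refine integral_congr_ae (ae_of_all _ fun ω => ?_)
  by_cases h : u < X 0 ω
  · have h' : u / τ < X 0 ω / τ := (div_lt_div_iff_of_pos_right hτ).2 h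
    simp [Set.indicator, h, h', div_div_div_cancel_right₀ hτ.ne']
  · have h' : ¬ u / τ < X 0 ω / τ := by rwa [div_lt_div_iff_of_pos_right hτ]
    simp [Set.indicator, h, h']

end Application

section Standardized

variable {Ω : Type*} [MeasurableSpace Ω] {P : Measure Ω} [IsProbabilityMeasure P]
  {ε : ℤ → Ω → ℝ} {v : ℝ≥0} {a : ℕ → ℝ} {τ : ℝ}

lemma hasLaw_linearProcess (hindep : iIndepFun ε P)
    (hlaw : ∀ t, HasLaw (ε t) (gaussianReal 0 v) P) (ha : Summable fun n => a n ^ 2) (t : ℤ) :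
    HasLaw (linearProcess a ε t) (gaussianReal 0 (v * autocov a 0).toNNReal) P := by
  simpa using hasLaw_sum_linearProcess hindep hlaw ha {()} (fun _ => 1) (fun _ => t)

lemma hasLaw_standardized_pair (hindep : iIndepFun ε P)
    (hlaw : ∀ t, HasLaw (ε t) (gaussianReal 0 v) P) (ha : Summable fun n => a n ^ 2)
    (hτ : 0 < τ) (hτ2 : τ ^ 2 = v * autocov a 0) (h0 : 0 < autocov a 0) (s t : ℤ) (x y : ℝ) :
    HasLaw (fun ω => x * (linearProcess a ε s ω / τ) + y * (linearProcess a ε t ω / τ))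
      (gaussianReal 0 (x ^ 2 + y ^ 2 + 2 * x * y *
        (autocov a (s - t).natAbs / autocov a 0)).toNNReal) P := by
  have h := hasLaw_sum_linearProcess hindep hlaw ha (Finset.univ : Finset (Fin 2))
    ![x / τ, y / τ] ![s, t]
  have hv : (v : ℝ) = τ ^ 2 / autocov a 0 := by
    rw [hτ2]
    field_simp
  simp only [Fin.sum_univ_two, Matrix.cons_val_zero, Matrix.cons_val_one, sub_self,
    Int.natAbs_zero] at h
  convert! h using 2
  · ring
  · rw [show (t - s).natAbs = (s - t).natAbs by omega, hv]
    congr 1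
    field_simp
    ring

lemma hasLaw_standardized_sum (hindep : iIndepFun ε P)
    (hlaw : ∀ t, HasLaw (ε t) (gaussianReal 0 v) P) (ha : Summable fun n => a n ^ 2)
    (hτ : 0 < τ) (hτ2 : τ ^ 2 = v * autocov a 0) (h0 : 0 < autocov a 0) (n : ℕ) :
    HasLaw (fun ω => ∑ t ∈ Finset.Icc 1 n, linearProcess a ε (t : ℤ) ω / τ)
      (gaussianReal 0 (toeplitzSum (fun k => autocov a k / autocov a 0) n).toNNReal) P := by
  have h := hasLaw_sum_linearProcess hindep hlaw ha (Finset.Icc 1 n) (fun _ => τ⁻¹)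
    (fun t : ℕ => (t : ℤ))
  have hv : (v : ℝ) = τ ^ 2 / autocov a 0 := by
    rw [hτ2]
    field_simp
  convert! h using 2
  · refine Finset.sum_congr rfl fun t _ => ?_
    rw [div_eq_inv_mul]
  · rw [toeplitzSum, Finset.mul_sum]
    congr 1
    refine Finset.sum_congr rfl fun s _ => ?_
    rw [Finset.mul_sum]
    refine Finset.sum_congr rfl fun t _ => ?_
    rw [hv]
    field_simp

end Standardized

end LongMemoryExtremes
theorem corollary6 {Ω : Type*} [MeasurableSpace Ω] (P : Measure Ω) [IsProbabilityMeasure P]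
    -- i.i.d. centered (non-degenerate) Gaussian innovations
    (ε : ℤ → Ω → ℝ) (v : ℝ≥0) (hv : v ≠ 0)
    (hindep : iIndepFun ε P)
    (hlaw : ∀ t, HasLaw (ε t) (gaussianReal 0 v) P)
    -- long memory coefficients
    (a : ℕ → ℝ) (d c : ℝ) (hmem : LongMemoryExtremes.LongMemory a (ε 0) P d c)
    -- the linear process and the standard deviation of its marginal distribution
    (X : ℤ → Ω → ℝ) (hX : X = LongMemoryExtremes.linearProcess a ε)
    (τ : ℝ) (hτ : τ = Real.sqrt (variance (X 0) P))
    -- thresholds `u n = τ (-2 log n (κ₀ + δ - 1/2 - d) + o(1))^{1/2} → ∞`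
    (u : ℕ → ℝ) (hu : Tendsto u atTop atTop)
    (δ : ℝ) (hδ : 0 < δ) (e : ℕ → ℝ) (he : Tendsto e atTop (𝓝 0))
    (hue : ∀ᶠ n : ℕ in atTop, u n = τ * Real.sqrt
      (-2 * Real.log n * (LongMemoryExtremes.kappaZero 2 d + δ - 1 / 2 - d) + e n)) :
    TendstoInDistribution
      (fun (n : ℕ) ω => (n : ℝ) ^ (1 / 2 - d) * τ ^ 2 / u n *
        LongMemoryExtremes.exceedanceError X P n (u n) ω)
      atTop (id : ℝ → ℝ) (fun _ => P)
      (gaussianReal 0 (Real.toNNReal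
        (LongMemoryExtremes.limitVariance c (∫ ω, ε 0 ω ^ 2 ∂P) d))) ∧
    TendstoInDistribution
      (fun (n : ℕ) ω => (n : ℝ) ^ (1 / 2 - d) * τ ^ 2 / u n *
        (LongMemoryExtremes.hillError X P n (u n) ω /
          LongMemoryExtremes.meanLogExcess X P (u n)))
      atTop (id : ℝ → ℝ) (fun _ => P)
      (gaussianReal 0 (Real.toNNReal
        (LongMemoryExtremes.limitVariance c (∫ ω, ε 0 ω ^ 2 ∂P) d))) ∧
    (fun n : ℕ => (n : ℝ) ^ (1 / 2 - d) * τ ^ 2 / u n) =o[atTop]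
      (fun n : ℕ => (n : ℝ) ^ (1 / 2 - d)) := by
  open LongMemoryExtremes in
  subst hX
  have ha := hmem.tendsto_coeff
  have hd0 := hmem.d_pos
  have hd := hmem.lt_half
  have hsq := summable_coeff_sq hd ha
  have hr0 := autocov_zero_pos hmem.c_ne_zero hsq ha
  have hv0 : (0 : ℝ) < v := NNReal.coe_pos.2 (pos_iff_ne_zero.2 hv)
  have hvr : 0 < v * autocov a 0 := mul_pos hv0 hr0
  have hτeq : τ = √(v * autocov a 0) := by
    rw [hτ, (hasLaw_linearProcess hindep hlaw hsq 0).variance_eq, variance_id_gaussianReal,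
      Real.coe_toNNReal _ hvr.le]
  have hτ0 : 0 < τ := by
    rw [hτeq]
    exact Real.sqrt_pos.2 hvr
  have hτ2 : τ ^ 2 = v * autocov a 0 := by
    rw [hτeq]
    exact Real.sq_sqrt hvr.le
  set X := linearProcess a ε with hX
  set W : ℤ → Ω → ℝ := fun t ω => X t ω / τ with hW
  set ρ : ℕ → ℝ := fun k => autocov a k / autocov a 0 with hρ
  have hpair := hasLaw_standardized_pair hindep hlaw hsq hτ0 hτ2 hr0
  have hsum := hasLaw_standardized_sum hindep hlaw hsq hτ0 hτ2 hr0
  have hWlaw : HasLaw (fun ω => X 0 ω / τ) (gaussianReal 0 1) P := by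
    simpa using hpair 0 0 1 0
  have hXm : ∀ t, AEMeasurable (X t) P := fun t =>
    (hasLaw_linearProcess hindep hlaw hsq t).aemeasurable
  -- exponents
  obtain ⟨hk1, hk2⟩ := half_sub_le_kappaZero hd0 hd
  set β : ℝ := 1 / 2 + d - kappaZero 2 d - δ with hβ
  have hβ1 : β < 2 * d := by linarith
  have hβ2 : β < 1 - 2 * d := by linarith
  obtain ⟨θ, hθ1, hθ2⟩ : ∃ θ, max 0 (4 * d - 1) < θ ∧ θ < 2 * d - β :=
    exists_between (max_lt (by linarith) (by linarith))
  have hθ0 : 0 < θ := lt_of_le_of_lt (le_max_left _ _) hθ1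
  have hθ3 : 4 * d - 1 < θ := lt_of_le_of_lt (le_max_right _ _) hθ1
  -- asymptotics of the autocovariances
  have hac := tendsto_autocov hd0 hd ha
  have hvar : Tendsto (fun n : ℕ => (n : ℝ) ^ (-(1 + 2 * d)) * (τ ^ 2 * toeplitzSum ρ n)) atTop
      (𝓝 (limitVariance c (∫ ω, ε 0 ω ^ 2 ∂P) d)) := by
    have h1 : Tendsto (fun n : ℕ => (n : ℝ) ^ (1 - 2 * d) * (τ ^ 2 * ρ n)) atTop
        (𝓝 (v * (c ^ 2 * beta (1 - 2 * d) d))) := by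
      refine (hac.const_mul (v : ℝ)).congr fun n => ?_
      simp only [hρ]
      rw [hτ2]
      field_simp
    have h2 := tendsto_toeplitzSum (by linarith : 0 < 2 * d) h1
    rw [integral_sq_of_hasLaw (hlaw 0)]
    convert! h2 using 2
    · rename_i n
      simp only [toeplitzSum, Finset.mul_sum]
    · rw [limitVariance]
      field_simp
  have hρ2 : Tendsto (fun n : ℕ => (n : ℝ) ^ (1 - θ) * ρ n ^ 2) atTop (𝓝 0) := by
    have h1 : Tendsto (fun n : ℕ => (n : ℝ) ^ (-(1 + θ - 4 * d))) atTop (𝓝 0) :=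
      (tendsto_rpow_neg_atTop (by linarith)).comp tendsto_natCast_atTop_atTop
    have h2 := h1.mul ((hac.div_const (autocov a 0)).pow 2)
    rw [zero_mul] at h2
    refine h2.congr' ?_
    filter_upwards [eventually_gt_atTop 0] with n hn0
    have hn1 : (0 : ℝ) < n := Nat.cast_pos.2 hn0
    have h3 : (n : ℝ) ^ (1 - θ) = (n : ℝ) ^ (-(1 + θ - 4 * d)) * ((n : ℝ) ^ (1 - 2 * d)) ^ 2 := by
      rw [← Real.rpow_natCast ((n : ℝ) ^ (1 - 2 * d)), ← Real.rpow_mul hn1.le,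
        ← Real.rpow_add hn1]
      congr 1
      push_cast
      ring
    rw [h3]
    simp only [hρ]
    ring
  -- thresholds
  set w : ℕ → ℝ := fun n => u n / τ with hw
  have hwt : Tendsto w atTop atTop := hu.atTop_div_const hτ0
  have hwe : ∀ᶠ n : ℕ in atTop, w n ^ 2 = 2 * β * Real.log n + e n := by
    filter_upwards [hue, hu.eventually_gt_atTop 0] with n hn hpos
    set q := -2 * Real.log n * (kappaZero 2 d + δ - 1 / 2 - d) + e n with hq
    have hq0 : 0 ≤ q := by
      by_contra! hneg
      rw [Real.sqrt_eq_zero_of_nonpos hneg.le, mul_zero] at hn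
      linarith
    simp only [hw]
    rw [hn, mul_div_cancel_left₀ _ hτ0.ne', Real.sq_sqrt hq0, hq, hβ]
    ring
  have hcore : ∀ g g' : ℕ → ℝ → ℝ, (∀ n, Measurable (g n)) →
      (∀ᶠ n in atTop, TailProfile (w n) (g n) (g' n)) → _ := fun g g' hgm hg =>
    tendstoInDistribution_tail_sum (W := W) (ρ := ρ) hpair hsum hθ0 (by linarith) hvar hρ2 he hwt
      hwe (g := g) (g' := g') hgm hg
  have hrate : ∀ n : ℕ, (n : ℝ) ^ (1 / 2 - d) * τ ^ 2 / u n
      = (n : ℝ) ^ (1 / 2 - d) * τ / w n := fun n => by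
    simp only [hw]
    field_simp
  refine ⟨?_, ?_, ?_⟩
  · refine tendstoInDistribution_congr_eventually (hcore (fun _ _ => 1) (fun _ _ => 0) (fun _ => measurable_const)
      ((hwt.eventually_ge_atTop 2).mono fun n hn => tailProfile_one hn)) ?_ ?_
    · intro n
      have : AEMeasurable (fun ω => ∑ t ∈ Finset.Icc 1 n,
          (Set.Ioi (u n)).indicator (fun _ => (1 : ℝ)) (X (t : ℤ) ω)) P :=
        Finset.aemeasurable_fun_sum _ fun t _ =>
          (measurable_const.indicator measurableSet_Ioi).comp_aemeasurable (hXm t)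
      exact ((this.div_const _).sub_const 1).const_mul _
    · refine Eventually.of_forall fun n => ?_
      funext ω
      have hs : ∑ t ∈ Finset.Icc 1 n, (Set.Ioi (u n)).indicator (fun _ => (1 : ℝ)) (X (t : ℤ) ω)
          = ∑ t ∈ Finset.Icc 1 n, (Set.Ioi (w n)).indicator (fun _ => 1) (W (t : ℤ) ω) := by
        refine Finset.sum_congr rfl fun t _ => ?_
        simp only [Set.indicator, Set.mem_Ioi, hw, hW, div_lt_div_iff_of_pos_right hτ0]
      rw [exceedanceError, hrate, tailProb_eq hτ0 hWlaw, hs]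
  · refine tendstoInDistribution_congr_eventually (hcore (fun n x => Real.log (x / w n)) (fun _ x => 1 / x) (fun n => by fun_prop)
      ((hwt.eventually_ge_atTop 2).mono fun n hn => tailProfile_log hn)) ?_ ?_
    · intro n
      have hm : Measurable (logExcess (u n)) := by
        unfold logExcess
        exact Measurable.indicator (by fun_prop) measurableSet_Ioi
      have : AEMeasurable (fun ω => ∑ t ∈ Finset.Icc 1 n, logExcess (u n) (X (t : ℤ) ω)) P :=
        Finset.aemeasurable_fun_sum _ fun t _ => hm.comp_aemeasurable (hXm t)
      exact (((this.div_const _).sub_const _).div_const _).const_mul _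
    · filter_upwards [hwt.eventually_ge_atTop 2, eventually_gt_atTop 0] with n hn hn0
      have hn1 : (n : ℝ) ≠ 0 := Nat.cast_ne_zero.2 hn0.ne'
      funext ω
      have hp : tailProb X P (u n) ≠ 0 := by
        rw [tailProb_eq hτ0 hWlaw]
        exact (tailProfile_one hn).integral_pos.ne'
      have hM := (tailProfile_log hn).integral_pos.ne'
      have hs : ∑ t ∈ Finset.Icc 1 n, logExcess (u n) (X (t : ℤ) ω) = ∑ t ∈ Finset.Icc 1 n,
          (Set.Ioi (w n)).indicator (fun x => Real.log (x / w n)) (W (t : ℤ) ω) := by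
        refine Finset.sum_congr rfl fun t _ => ?_
        simp only [logExcess, Set.indicator, Set.mem_Ioi, hw, hW,
          div_lt_div_iff_of_pos_right hτ0, div_div_div_cancel_right₀ hτ0.ne']
      rw [hillError, hrate, meanLogExcess_eq hτ0 hWlaw, hs, show u n / τ = w n from rfl]
      generalize ∫ x, (Set.Ioi (w n)).indicator (fun x => Real.log (x / w n)) x
        ∂(gaussianReal 0 1) = M at hM ⊢
      generalize ∑ t ∈ Finset.Icc 1 n, (Set.Ioi (w n)).indicator
        (fun x => Real.log (x / w n)) (W (t : ℤ) ω) = S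
      generalize tailProb X P (u n) = p at hp ⊢
      field_simp
  · have hinv : Tendsto (fun n => τ ^ 2 / u n) atTop (𝓝 0) := hu.const_div_atTop _
    have h1 := (Asymptotics.isBigO_refl (fun n : ℕ => (n : ℝ) ^ (1 / 2 - d)) atTop).mul_isLittleO
      ((Asymptotics.isLittleO_one_iff ℝ).2 hinv)
    simpa only [mul_one, mul_div_assoc] using h1
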